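/- Let $k$ be a perfect field of characteristic $p>0$. A normal $k$-variety is an integral, separated scheme of finite type over $k$ all of whose local rings are integrally closed. A finite surjective morphism $g\colon X\to Z$ of normal $k$-varieties is called purely inseparable if the extension of function fields $k(Z)\subseteq k(X)$ is purely inseparable; it is called purely inseparable of height one if, moreover, there is a morphism of schemes $h\colon Z\to X$ (not necessarily over $k$) such that $h\circ g=F_X$ is the absolute Frobenius of $X$. For a finite surjective $k$-morphism $f\colon X\to Y$ of normal $k$-varieties let $\mathcal F_f\subseteq\mathcal T_X=(\Omega^1_X)^\vee$ be the subsheaf of the derivations that annihilate $f^{-1}\mathcal O_Y\subseteq\mathcal O_X$. A foliation on $X$ is a saturated $\mathcal O_X$-submodule sheaf of $\mathcal T_X$ closed under the Lie bracket; it is $p$-closed if it contains the $p$-fold composition of each of its sections. The quotient of $X$ by a foliation $\mathcal F$ is the $k$-morphism $X\to\operatorname{Spec}_X\mathcal A_{\mathcal F}$, where $\mathcal A_{\mathcal F}\subseteq (F_X)_*\mathcal O_X$ is the sheaf of functions annihilated by $\mathcal F$, with $\mathcal O_X$ acting through $p$-th powers. Proposition (factorisation). Let $f\colon X\to Y$ be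 a purely inseparable $k$-morphism of normal $k$-varieties. Then there exist a positive integer $l$, normal $k$-varieties $Z_1,\dots,Z_l$ with $Z_1=X$ and $Z_l=Y$, and $k$-morphisms $$X=Z_1\to Z_2\to\cdots\to Z_l=Y$$ whose composite is $f$ (for $l=1$ this means that $X=Y$ and $f$ is the identity), such that for every $1\le i<l$ the morphism $Z_i\to Z_{i+1}$ is purely inseparable of height one. Moreover, they can be chosen so that for every $1\le i<l$, if $f_i\colon Z_i\to Y$ denotes the composite of the morphisms from $Z_i$ on, then $\mathcal F_{f_i}$ is a $p$-closed foliation on $Z_i$ and $Z_i\to Z_{i+1}$ is, up to isomorphism, the quotient of $Z_i$ by $\mathcal F_{f_i}$. -/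

import Mathlib

universe u

open CategoryTheory AlgebraicGeometry TopologicalSpace Opposite

namespace InsepFactor

noncomputable section

/-! ### Normal varieties -/

/-- A `k`-scheme is a normal `k`-variety if it is integral, separated and of finite type over `k`,
and all its local rings are integrally closed domains. -/
structure IsNormalVariety (k : Type u) [Field k] (X : Over (Spec (CommRingCat.of k))) : Prop where
  isIntegral : IsIntegral X.left
  isSeparated : IsSeparated X.hom
  locallyOfFiniteType : LocallyOfFiniteType X.hom
  quasiCompact : QuasiCompact X.hom
  normal : ∀ x : X.left, IsIntegrallyClosed (X.left.presheaf.stalk x)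

/-- The category of normal `k`-varieties and `k`-morphisms. -/
abbrev NormalVariety (k : Type u) [Field k] :=
  ObjectProperty.FullSubcategory (IsNormalVariety k)

/-- The underlying scheme of a normal `k`-variety. -/
abbrev NormalVariety.scheme {k : Type u} [Field k] (X : NormalVariety k) : Scheme.{u} :=
  X.obj.left

/-- The morphism of schemes underlying a `k`-morphism. -/
abbrev schemeMap {k : Type u} [Field k] {X Y : NormalVariety k} (f : X ⟶ Y) :
    X.scheme ⟶ Y.scheme :=
  f.hom.left

instance {k : Type u} [Field k] (X : NormalVariety k) : IsIntegral X.scheme :=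
  X.property.isIntegral

/-- The constant functions on an open subset. -/
def constants {k : Type u} [Field k] (X : NormalVariety k) (U : X.scheme.Opens) :
    k →+* Γ(X.scheme, U) :=
  (X.scheme.presheaf.map (homOfLE (le_top : U ≤ ⊤)).op).hom.comp
    ((X.obj.hom.appTop).hom.comp (Scheme.ΓSpecIso (CommRingCat.of k)).inv.hom)

/-! ### The absolute Frobenius -/

lemma natCast_sections_eq_zero (p : ℕ) (X : Scheme.{u}) (hX : (p : Γ(X, ⊤)) = 0) (U : X.Opens) :
    (p : Γ(X, U)) = 0 := by
  have := congrArg (X.presheaf.map (homOfLE (le_top : U ≤ ⊤)).op).hom hX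
  simpa using this

/-- The `p`-th power map of a commutative ring in which the prime `p` is zero. -/
def powHom (p : ℕ) [hp : Fact p.Prime] (R : Type u) [CommRing R] (hR : (p : R) = 0) : R →+* R where
  toFun s := s ^ p
  map_one' := one_pow p
  map_mul' a b := mul_pow a b p
  map_zero' := zero_pow hp.out.ne_zero
  map_add' a b := by rw [add_pow_prime_eq hp.out a b, hR]; ring

/-- The absolute Frobenius as a morphism of ringed spaces. -/
def frobeniusHom (p : ℕ) [Fact p.Prime] (X : Scheme.{u}) (hX : (p : Γ(X, ⊤)) = 0) :
    X.toPresheafedSpace ⟶ X.toPresheafedSpace where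
  base := 𝟙 _
  c :=
    { app := fun U => CommRingCat.ofHom
        (powHom p Γ(X, U.unop) (natCast_sections_eq_zero p X hX U.unop))
      naturality := by
        intro U V i
        ext s
        exact (map_pow (X.presheaf.map i).hom s p).symm }

/-- The absolute Frobenius of a scheme of characteristic `p`: the identity on the underlying
topological space and `s ↦ s ^ p` on functions. -/
def absoluteFrobenius (p : ℕ) [hp : Fact p.Prime] (X : Scheme.{u}) (hX : (p : Γ(X, ⊤)) = 0) :
    X ⟶ X where
  toHom := frobeniusHom p X hX
  prop := by
    intro x
    refine ⟨fun a ha => ?_⟩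
    obtain ⟨U, hxU, s, rfl⟩ := X.presheaf.exists_germ_eq a
    have h : ((frobeniusHom p X hX).stalkMap x).hom
        (X.presheaf.germ U ((frobeniusHom p X hX).base x) hxU s) =
        X.presheaf.germ U x hxU (s ^ p) :=
      PresheafedSpace.stalkMap_germ_apply (frobeniusHom p X hX) U x hxU s
    have h2 : IsUnit ((X.presheaf.germ U x hxU s) ^ p) := by
      rw [← map_pow, ← h]
      exact ha
    exact (isUnit_pow_iff hp.out.ne_zero).mp h2

/-- The absolute Frobenius is the identity on points. -/
lemma absoluteFrobenius_apply (p : ℕ) [Fact p.Prime] (X : Scheme.{u})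
    (hX : (p : Γ(X, ⊤)) = 0) (x : X) : absoluteFrobenius p X hX x = x :=
  rfl

/-- The absolute Frobenius is the `p`-th power map on functions. -/
lemma absoluteFrobenius_app (p : ℕ) [Fact p.Prime] (X : Scheme.{u})
    (hX : (p : Γ(X, ⊤)) = 0) (U : X.Opens) (s : Γ(X, U)) :
    (absoluteFrobenius p X hX).app U s = s ^ p :=
  rfl

lemma natCast_eq_zero (p : ℕ) {k : Type u} [Field k] [CharP k p] (X : NormalVariety k) :
    (p : Γ(X.scheme, ⊤)) = 0 := by
  rw [← map_natCast (constants X ⊤), CharP.cast_eq_zero, map_zero]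

/-- The absolute Frobenius `F_X` of a normal variety in characteristic `p`. -/
def frob (p : ℕ) [Fact p.Prime] {k : Type u} [Field k] [CharP k p] (X : NormalVariety k) :
    X.scheme ⟶ X.scheme :=
  absoluteFrobenius p X.scheme (natCast_eq_zero p X)

/-! ### Purely inseparable morphisms -/

lemma map_genericPoint {X Y : Scheme.{u}} [IsIntegral X] [IsIntegral Y] (g : X ⟶ Y)
    (hg : Surjective g) : g (genericPoint X) = genericPoint Y := by
  apply ((genericPoint_spec Y).eq _).symm
  have h := (genericPoint_spec X).image g.continuous
  rw [Set.image_univ, hg.surj.range_eq, closure_univ] at h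
  exact h

/-- The extension of function fields `k(Y) → k(X)` induced by a surjective morphism `X → Y` of
integral schemes. -/
def functionFieldMap {X Y : Scheme.{u}} [IsIntegral X] [IsIntegral Y] (g : X ⟶ Y)
    (hg : Surjective g) : Y.functionField →+* X.functionField :=
  (Y.presheaf.stalkSpecializes (specializes_of_eq (map_genericPoint g hg)) ≫
    g.stalkMap (genericPoint X)).hom

/-- A purely inseparable morphism of integral schemes: finite, surjective, with purely
inseparable extension of function fields. -/
def IsPurelyInseparableHom {X Y : Scheme.{u}} [IsIntegral X] [IsIntegral Y] (g : X ⟶ Y) : Prop :=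
  IsFinite g ∧ ∃ hg : Surjective g,
    @IsPurelyInseparable Y.functionField X.functionField _ _ (functionFieldMap g hg).toAlgebra

/-- A purely inseparable `k`-morphism `g : X → Z` has height one if the absolute Frobenius of `X`
factors through `g`, by a morphism that need not be over `k`. -/
def IsPurelyInseparableOfHeightOne (p : ℕ) [Fact p.Prime] {k : Type u} [Field k] [CharP k p]
    {X Z : NormalVariety k} (g : X ⟶ Z) : Prop :=
  IsPurelyInseparableHom (schemeMap g) ∧
    ∃ h : Z.scheme ⟶ X.scheme, schemeMap g ≫ h = frob p X

/-! ### Vector fields and foliations -/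

variable {k : Type u} [Field k]

/-- Restriction of functions. -/
def res {X : NormalVariety k} {U V : X.scheme.Opens} (h : V ≤ U) :
    Γ(X.scheme, U) →+* Γ(X.scheme, V) :=
  (X.scheme.presheaf.map (homOfLE h).op).hom

/-- A section over `U` of the tangent sheaf `T_X`, the dual of the sheaf of Kähler differentials
of `X` over `k`: by the universal property, a `k`-linear derivation of the sheaf of rings
`O_X` restricted to `U`. -/
@[ext]
structure TangentSection (X : NormalVariety k) (U : X.scheme.Opens) where
  der : ∀ V : X.scheme.Opens, V ≤ U → Derivation ℤ Γ(X.scheme, V) Γ(X.scheme, V)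
  der_constants : ∀ V hV (a : k), der V hV (constants X V a) = 0
  der_res : ∀ V hV W (h : W ≤ V) (s : Γ(X.scheme, V)),
    der W (h.trans hV) (res h s) = res h (der V hV s)

namespace TangentSection

variable {X : NormalVariety k} {U : X.scheme.Opens}

/-- Restriction of vector fields. -/
def restrict (D : TangentSection X U) {V : X.scheme.Opens} (h : V ≤ U) : TangentSection X V where
  der W hW := D.der W (hW.trans h)
  der_constants W hW := D.der_constants W (hW.trans h)
  der_res W hW := D.der_res W (hW.trans h)

instance : Zero (TangentSection X U) where
  zero :=
    { der := fun _ _ => 0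
      der_constants := by intros; rfl
      der_res := by intros; simp }

instance : Add (TangentSection X U) where
  add D E :=
    { der := fun V hV => D.der V hV + E.der V hV
      der_constants := by intros; simp [D.der_constants, E.der_constants]
      der_res := by
        intro V hV W h s
        simp [D.der_res V hV W h, E.der_res V hV W h] }

instance : SMul Γ(X.scheme, U) (TangentSection X U) where
  smul r D :=
    { der := fun V hV => res hV r • D.der V hV
      der_constants := by intros; simp [D.der_constants]
      der_res := by
        intro V hV W h s
        have : res (h.trans hV) r = res h (res hV r) := by
          simp only [res, ← RingHom.comp_apply, ← CommRingCat.hom_comp, ← Functor.map_comp]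
          rfl
        simp [D.der_res V hV W h, this] }

/-- The Lie bracket of vector fields. -/
instance : Bracket (TangentSection X U) (TangentSection X U) where
  bracket D E :=
    { der := fun V hV => ⁅D.der V hV, E.der V hV⁆
      der_constants := by
        intros; simp [Derivation.commutator_apply, D.der_constants, E.der_constants]
      der_res := by
        intro V hV W h s
        simp [Derivation.commutator_apply, D.der_res V hV W h, E.der_res V hV W h] }

end TangentSection

/-- A family of sets of sections of the tangent sheaf is a foliation if it is a subsheaf of
`O_X`-modules that is saturated (the quotient is torsion free) and closed under the Lie bracket. -/
structure IsFoliation {X : NormalVariety k} (F : ∀ U : X.scheme.Opens, Set (TangentSection X U)) :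
    Prop where
  zero_mem : ∀ U, 0 ∈ F U
  add_mem : ∀ U, ∀ D ∈ F U, ∀ E ∈ F U, D + E ∈ F U
  smul_mem : ∀ U (r : Γ(X.scheme, U)), ∀ D ∈ F U, r • D ∈ F U
  restrict_mem : ∀ U, ∀ D ∈ F U, ∀ V (h : V ≤ U), D.restrict h ∈ F V
  mem_of_local : ∀ U (D : TangentSection X U),
    (∀ x ∈ U, ∃ (V : X.scheme.Opens) (h : V ≤ U), x ∈ V ∧ D.restrict h ∈ F V) → D ∈ F U
  saturated : ∀ U (r : Γ(X.scheme, U)) (D : TangentSection X U), r ≠ 0 → r • D ∈ F U → D ∈ F U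
  bracket_mem : ∀ U, ∀ D ∈ F U, ∀ E ∈ F U, ⁅D, E⁆ ∈ F U

/-- A foliation is `p`-closed if it contains the `p`-fold composition of each of its sections. -/
structure IsPClosedFoliation (p : ℕ) {X : NormalVariety k}
    (F : ∀ U : X.scheme.Opens, Set (TangentSection X U)) : Prop extends IsFoliation F where
  pow_mem : ∀ U, ∀ D ∈ F U, ∃ E ∈ F U, ∀ V hV (s : Γ(X.scheme, V)),
    E.der V hV s = (D.der V hV)^[p] s

/-- The subsheaf `f⁻¹O_Y` of `O_X`: the functions that are locally pulled back from `Y`. -/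
def inverseImageSections {X Y : NormalVariety k} (f : X ⟶ Y) (V : X.scheme.Opens) :
    Set Γ(X.scheme, V) :=
  {s | ∀ x ∈ V, ∃ (W : Y.scheme.Opens) (t : Γ(Y.scheme, W)) (V' : X.scheme.Opens)
    (h : V' ≤ V) (h' : V' ≤ (schemeMap f) ⁻¹ᵁ W),
    x ∈ V' ∧ res h s = res h' ((schemeMap f).app W t)}

/-- The foliation `F_f` attached to `f : X → Y`: the vector fields that annihilate `f⁻¹O_Y`. -/
def foliationOf {X Y : NormalVariety k} (f : X ⟶ Y) (U : X.scheme.Opens) :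
    Set (TangentSection X U) :=
  {D | ∀ V hV, ∀ s ∈ inverseImageSections f V, D.der V hV s = 0}

/-- The sheaf `A_F` of functions annihilated by `F`. -/
def annihilated {X : NormalVariety k} (F : ∀ U : X.scheme.Opens, Set (TangentSection X U))
    (U : X.scheme.Opens) : Set Γ(X.scheme, U) :=
  {s | ∀ V (h : V ≤ U), ∀ D ∈ F V, D.der V le_rfl (res h s) = 0}

/-- The `k`-morphism `g : X → Z` is the quotient of `X` by `F`, that is, it is (isomorphic to)
`X → Spec_X A_F`, where `A_F` is an `O_X`-algebra by `r • s = r ^ p * s`: there is an affine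
morphism `h : Z → X` with `h ∘ g = F_X` the absolute Frobenius, such that `g` identifies
`h_* O_Z` with the subsheaf `A_F` of `(F_X)_* O_X`. -/
def IsQuotientBy (p : ℕ) [Fact p.Prime] [CharP k p] {X Z : NormalVariety k}
    (F : ∀ U : X.scheme.Opens, Set (TangentSection X U)) (g : X ⟶ Z) : Prop :=
  ∃ h : Z.scheme ⟶ X.scheme, schemeMap g ≫ h = frob p X ∧ IsAffineHom h ∧
    ∀ U : X.scheme.Opens,
      Function.Injective ((schemeMap g).app (h ⁻¹ᵁ U)) ∧
      Set.range ((schemeMap g).app (h ⁻¹ᵁ U)) = annihilated F (schemeMap g ⁻¹ᵁ h ⁻¹ᵁ U)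

end

end InsepFactor

open InsepFactor

/-!
Put `K = k(X)` and `L = k(Y)`, and suppose that `K ^ (p ^ (e + 1)) ⊆ L`. Let `Z` be the
normalisation of `Y` in the compositum `M = L K ^ p`. Since `K ^ p ⊆ M`, the morphism `X → Z` has
height one, and since `M ^ (p ^ e) ⊆ L`, the morphism `Z → Y` is handled by induction on `e`. A
vector field that kills `O_Y` also kills all `p`-th powers, hence `O_Z`, so `X → Z` and `X → Y` have
the same foliation. A function annihilated by this foliation lies in `O_Z`: the elements of `K`
killed by all `M`-linear derivations are those of `M`, such a derivation becomes regular on an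
affine open set after multiplication by a nonzero function, and `O_Z` consists of the functions on
`X` that lie in `M`, because `Z` is normal.
-/

namespace InsepFactor

noncomputable section

open AlgebraicGeometry.Scheme AffineZariskiSite

/-! ### Derivations in characteristic `p` -/

section FieldTheory
variable (p : ℕ) [Fact p.Prime]

open Polynomial IntermediateField in
-- Write `s = q(a)` with `deg q` below the degree of `a`. If `q' = 0`, then `q` is a polynomial in
-- `X ^ p`, so `s` lies in `E`; otherwise `q'(a) ≠ 0`, while `q'(a) * D a = D s = 0`.
lemma derivation_apply_eq_zero_of_mem_adjoin_simple {E K : Type*} [Field E] [Field K] [Algebra E K]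
    [CharP E p] (D : Derivation E K K) {a s : K} (ha : a ^ p ∈ (algebraMap E K).range)
    (hsa : s ∈ E⟮a⟯) (hs : s ∉ (algebraMap E K).range) (hDs : D s = 0) : D a = 0 := by
  obtain ⟨c, hc⟩ := ha
  have hint : _root_.IsIntegral E a :=
    .of_pow (Fact.out : p.Prime).pos (hc ▸ isIntegral_algebraMap)
  rw [← mem_toSubalgebra, adjoin_simple_toSubalgebra_of_isAlgebraic hint.isAlgebraic,
    Algebra.adjoin_singleton_eq_range_aeval] at hsa
  obtain ⟨r, rfl : aeval a r = s⟩ := hsa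
  set q := r %ₘ minpoly E a
  have hqs : aeval a q = aeval a r := aeval_modByMonic_eq_self_of_root (minpoly.aeval E a)
  have hqdeg : q.degree < (minpoly E a).degree := degree_modByMonic_lt r (minpoly.monic hint)
  rw [← hqs] at hs hDs
  have hq' : derivative q ≠ 0 := fun h0 ↦ hs ⟨aeval c (contract p q), by
    rw [← aeval_algebraMap_apply, hc, ← expand_aeval, expand_contract p h0 (NeZero.ne p)]⟩
  have hq'a : aeval a (derivative q) ≠ 0 := fun h0 ↦
    (minpoly.degree_le_of_ne_zero E a hq' h0).not_gt ((degree_derivative_le).trans_lt hqdeg)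
  rw [D.map_aeval, smul_eq_mul] at hDs
  exact (mul_eq_zero.mp hDs).resolve_left hq'a

lemma surjective_algebraMap_of_forall_derivation_eq_zero {E K : Type*} [Field E] [Field K]
    [Algebra E K] [Algebra.EssFiniteType E K] [IsPurelyInseparable E K]
    (h : ∀ D : Derivation E K K, D = 0) : Function.Surjective (algebraMap E K) := by
  have : Subsingleton (Derivation E K K) := ⟨fun D D' ↦ (h D).trans (h D').symm⟩
  have : Subsingleton (Module.Dual K Ω[K⁄E]) :=
    (KaehlerDifferential.linearMapEquivDerivation E K).injective.subsingleton
  have : Algebra.FormallyUnramified E K := ⟨(Module.subsingleton_dual_iff K).mp this⟩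
  have := Algebra.FormallyUnramified.isSeparable E K
  exact IsPurelyInseparable.surjective_algebraMap_of_isSeparable E K

open IntermediateField in
lemma exists_derivation_apply_ne_zero {L K : Type*} [Field L] [Field K] [Algebra L K] [CharP L p]
    [FiniteDimensional L K] (hpow : ∀ x : K, x ^ p ∈ (algebraMap L K).range) {s : K}
    (hs : s ∉ (algebraMap L K).range) : ∃ D : Derivation L K K, D s ≠ 0 := by
  by_contra! hD
  obtain ⟨E, hsE, hE⟩ := (InvImage.wf (fun E : IntermediateField L K ↦ E.toSubalgebra.toSubmodule)
    wellFounded_gt).has_min {E | s ∉ E} ⟨⊥, by simpa [mem_bot] using hs⟩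
  have hpowE (x : K) : x ^ p ∈ (algebraMap E K).range :=
    (hpow x).imp' (algebraMap L E) fun _ ↦ id
  have : CharP E p := charP_of_injective_algebraMap (algebraMap L E).injective p
  have : IsPurelyInseparable E K :=
    (isPurelyInseparable_iff_pow_mem E p).mpr fun x ↦ ⟨1, by simpa using hpowE x⟩
  have hzero (D : Derivation E K K) : D = 0 := by
    ext a
    by_cases ha : a ∈ E
    · exact D.map_algebraMap (⟨a, ha⟩ : E)
    have hsa : s ∈ E⟮a⟯ := by
      by_contra hsa
      refine hE (E⟮a⟯.restrictScalars L) hsa (SetLike.lt_iff_le_and_exists.mpr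
        ⟨fun x hx ↦ E⟮a⟯.algebraMap_mem ⟨x, hx⟩, a, mem_adjoin_simple_self E a, ha⟩)
    exact derivation_apply_eq_zero_of_mem_adjoin_simple p D (hpowE a) hsa
      (fun ⟨c, hc⟩ ↦ hsE (hc ▸ c.2)) (hD (D.restrictScalars L))
  obtain ⟨c, hc⟩ := surjective_algebraMap_of_forall_derivation_eq_zero hzero s
  exact hsE (hc ▸ c.2)

end FieldTheory

section Derivation
variable {A : Type*} [CommRing A] (D : Derivation ℤ A A)

lemma iterate_derivation_mul (n : ℕ) (a b : A) :
    D^[n] (a * b) =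
      ∑ ij ∈ Finset.HasAntidiagonal.antidiagonal n, n.choose ij.1 • (D^[ij.1] a * D^[ij.2] b) := by
  induction n with
  | zero => simp
  | succ n ih =>
    rw [Finset.sum_antidiagonal_choose_succ_nsmul (fun i j ↦ D^[i] a * D^[j] b) n,
      Function.iterate_succ_apply', ih, map_sum, ← Finset.sum_add_distrib]
    refine Finset.sum_congr rfl fun ij hij ↦ ?_
    rw [n.choose_symm_of_eq_add (Finset.HasAntidiagonal.mem_antidiagonal.mp hij).symm, map_nsmul,
      D.leibniz, Function.iterate_succ_apply', Function.iterate_succ_apply', smul_eq_mul,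
      smul_eq_mul, mul_comm (D^[ij.2] b), smul_add]

/-- The `p`-fold composition of a derivation of a ring in which the prime `p` is zero. -/
def powDerivation (p : ℕ) [hp : Fact p.Prime] (hA : (p : A) = 0) : Derivation ℤ A A :=
  .mk' ((D : A →ₗ[ℤ] A) ^ p) fun a b ↦ by
    have hcoe (x : A) : ((D : A →ₗ[ℤ] A) ^ p) x = D^[p] x := Module.End.pow_apply _ _ _
    simp only [hcoe]
    rw [iterate_derivation_mul, Finset.Nat.sum_antidiagonal_eq_sum_range_succ_mk,
      Finset.sum_range_succ, Finset.sum_eq_single_of_mem 0 (Finset.mem_range.mpr hp.out.pos)]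
    · simp [mul_comm b]
    · intro i hi hi0
      obtain ⟨c, hc⟩ := hp.out.dvd_choose_self hi0 (Finset.mem_range.mp hi)
      rw [hc, ← Nat.cast_smul_eq_nsmul A, Nat.cast_mul, hA, zero_mul, zero_smul]

lemma powDerivation_apply (p : ℕ) [Fact p.Prime] (hA : (p : A) = 0) (a : A) :
    powDerivation D p hA a = D^[p] a :=
  Module.End.pow_apply _ _ _

/-- The subring of the elements killed by a derivation. -/
def derivationKer : Subring A where
  carrier := {a | D a = 0}
  mul_mem' {a b} ha hb := by simp_all
  one_mem' := by simp
  add_mem' {a b} ha hb := by simp_all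
  zero_mem' := by simp
  neg_mem' {a} ha := by simp_all

lemma pow_mem_derivationKer {p : ℕ} (hA : (p : A) = 0) (a : A) : a ^ p ∈ derivationKer D := by
  change D (a ^ p) = 0
  rw [D.leibniz_pow, ← Nat.cast_smul_eq_nsmul A, hA, zero_smul]

variable {K : Type*} [Field K] [Algebra A K]

lemma mem_derivationKer_of_mem_closure [FaithfulSMul A K] {s : A}
    (hs : algebraMap A K s ∈ Subfield.closure (algebraMap A K '' derivationKer D)) :
    s ∈ derivationKer D := by
  have hinj := FaithfulSMul.algebraMap_injective A K
  have := hinj.isDomain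
  rw [Subfield.mem_closure_iff, ← RingHom.map_closure, Subring.closure_eq] at hs
  obtain ⟨_, ⟨a, ha, rfl⟩, _, ⟨b, hb, rfl⟩, hab⟩ := hs
  obtain rfl | hb0 := eq_or_ne b 0
  · have : s = 0 := hinj (by rw [← hab, map_zero, div_zero])
    exact this ▸ zero_mem _
  have hsb : s * b = a := hinj <| by
    rw [map_mul, ← hab, div_mul_cancel₀ _ ((map_ne_zero_iff _ hinj).mpr hb0)]
  have hD : D (s * b) = 0 := hsb ▸ ha
  rw [D.leibniz, show D b = 0 from hb, smul_zero, zero_add, smul_eq_mul] at hD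
  exact (mul_eq_zero.mp hD).resolve_left hb0

lemma pow_mem_closure_derivationKer [IsFractionRing A K] {p : ℕ} (hA : (p : A) = 0) (x : K) :
    x ^ p ∈ Subfield.closure (algebraMap A K '' derivationKer D) := by
  obtain ⟨a, b, -, rfl⟩ := IsFractionRing.div_surjective (A := A) x
  rw [div_pow, ← map_pow, ← map_pow]
  exact div_mem (Subfield.subset_closure ⟨_, pow_mem_derivationKer D hA a, rfl⟩)
    (Subfield.subset_closure ⟨_, pow_mem_derivationKer D hA b, rfl⟩)

end Derivation

lemma exists_derivation_restrict {A K : Type*} [CommRing A] [CommRing K] (i : A →+* K)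
    (hi : Function.Injective i) (E : Derivation ℤ K K) (h : ∀ a, ∃ a', i a' = E (i a)) :
    ∃ D : Derivation ℤ A A, ∀ a, i (D a) = E (i a) := by
  choose d hd using h
  let D₀ : A →+ A :=
    { toFun := d
      map_zero' := hi (by simp [hd])
      map_add' := fun a b ↦ hi (by simp [hd]) }
  refine ⟨.mk' D₀.toIntLinearMap fun a b ↦ hi ?_, hd⟩
  change i (d (a * b)) = i (a * d b + b * d a)
  simp [hd]

lemma pow_mem_of_mem_closure {K : Type*} [Field K] (p : ℕ) [ExpChar K p] (L : Subfield K) {e : ℕ}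
    (hL : ∀ x : K, x ^ p ^ (e + 1) ∈ L) {x : K}
    (hx : x ∈ Subfield.closure (↑L ∪ Set.range (fun x : K ↦ x ^ p))) : x ^ p ^ e ∈ L := by
  have hle : Subfield.closure (↑L ∪ Set.range (fun x : K ↦ x ^ p)) ≤
      L.comap (iterateFrobenius K p e) := by
    rw [Subfield.closure_le]
    rintro y (hy | ⟨y, rfl⟩)
    · exact L.pow_mem hy _
    · change (y ^ p) ^ p ^ e ∈ L
      rw [← pow_mul, ← pow_succ']
      exact hL y
  exact hle hx

/-! ### Quasi-coherent subalgebras and their spectra -/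

lemma isLocalization_away_restrict {B B' : Type*} [CommRing B] [CommRing B'] (φ : B →+* B')
    {A : Subring B} {A' : Subring B'} (hφ : ∀ a ∈ A, φ a ∈ A') (r : A)
    (hB' : letI := φ.toAlgebra; IsLocalization.Away r.1 B')
    (hunit : IsUnit (φ.restrict A A' hφ r))
    (hA' : ∀ b, φ b ∈ A' → ∃ n : ℕ, r.1 ^ n * b ∈ A) :
    letI := (φ.restrict A A' hφ).toAlgebra
    IsLocalization.Away r A' := by
  let := φ.toAlgebra
  let := (φ.restrict A A' hφ).toAlgebra
  refine .mk r hunit (fun b ↦ ?_) fun a a' h ↦ ?_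
  · obtain ⟨m, a, ha⟩ := IsLocalization.Away.surj r.1 b.1
    obtain ⟨n, hn⟩ := hA' a (ha ▸ mul_mem b.2 (pow_mem (hφ r r.2) m))
    refine ⟨n + m, ⟨_, hn⟩, Subtype.ext ?_⟩
    change b.1 * φ r ^ (n + m) = φ (r ^ n * a)
    rw [map_mul, map_pow, pow_add, mul_left_comm]
    exact congrArg _ ha
  · obtain ⟨n, hn⟩ := IsLocalization.Away.exists_of_eq r.1 (S := B') (congrArg Subtype.val h)
    exact ⟨n, Subtype.ext hn⟩

lemma isLocalization_away_preimage_basicOpen {X Y : Scheme.{u}} (f : X ⟶ Y) [QuasiCompact f]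
    [QuasiSeparated f] {U : Y.Opens} (hU : IsAffineOpen U) (t : Γ(Y, U)) :
    letI := (X.presheaf.map (homOfLE (f.preimage_mono (Y.basicOpen_le t))).op).hom.toAlgebra
    IsLocalization.Away (f.app U t) Γ(X, f ⁻¹ᵁ Y.basicOpen t) := by
  have hloc (W : X.Opens) (hW : W ≤ f ⁻¹ᵁ U) (e : W = X.basicOpen (f.app U t)) :
      letI := (X.presheaf.map (homOfLE hW).op).hom.toAlgebra
      IsLocalization.Away (f.app U t) Γ(X, W) := by
    subst e
    exact isLocalization_basicOpen_of_qcqs (f.isCompact_preimage hU.isCompact)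
      (f.isQuasiSeparated_preimage hU.isQuasiSeparated) _
  exact hloc _ _ (f.preimage_basicOpen t)

lemma exists_hom_of_affine_cover {X Y T : Scheme.{u}} (f : X ⟶ Y)
    (g : ∀ U : Y.AffineZariskiSite, (f ⁻¹ᵁ U.1).toScheme ⟶ T)
    (hg : ∀ (U V : Y.AffineZariskiSite) (i : U ⟶ V),
      X.homOfLE (f.preimage_mono (toOpens_mono i.le)) ≫ g V = g U) :
    ∃ h : X ⟶ T, ∀ U, (f ⁻¹ᵁ U.1).ι ≫ h = g U := by
  let 𝒰 : X.OpenCover := (directedCover Y).pullback₁ f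
  let e (U : Y.AffineZariskiSite) : 𝒰.X U ≅ (f ⁻¹ᵁ U.1).toScheme :=
    pullbackRestrictIsoRestrict f U.1
  have he (U : Y.AffineZariskiSite) : (e U).hom ≫ (f ⁻¹ᵁ U.1).ι = 𝒰.f U :=
    pullbackRestrictIsoRestrict_hom_ι f U.1
  have htrans (U V : Y.AffineZariskiSite) (i : U ⟶ V) :
      Cover.trans 𝒰 i ≫ (e V).hom =
        (e U).hom ≫ X.homOfLE (f.preimage_mono (toOpens_mono i.le)) := by
    rw [← cancel_mono (f ⁻¹ᵁ V.1).ι, Category.assoc, Category.assoc, he, homOfLE_ι, he]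
    exact Cover.trans_map 𝒰 i
  refine ⟨𝒰.glueMorphismsOfLocallyDirected (fun U ↦ (e U).hom ≫ g U) fun {U V} i ↦ ?_, fun U ↦ ?_⟩
  · rw [← hg U V i]
    exact congr($(htrans U V i) ≫ g V)
  · rw [← cancel_epi (e U).hom, ← Category.assoc, he]
    exact 𝒰.map_glueMorphismsOfLocallyDirected _ _ _

lemma toSpecΓ_SpecMap_app_fromSpec {X Y : Scheme.{u}} (f : X ⟶ Y) {U : Y.Opens}
    (hU : IsAffineOpen U) :
    (f ⁻¹ᵁ U).toSpecΓ ≫ Spec.map (f.app U) ≫ hU.fromSpec = (f ⁻¹ᵁ U).ι ≫ f := by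
  simp

lemma isIso_appLE_of_eq_opensRange {X Y : Scheme.{u}} (j : X ⟶ Y) [IsOpenImmersion j]
    {V : Y.Opens} (hV : V = j.opensRange) (h : ⊤ ≤ j ⁻¹ᵁ V) : IsIso (j.appLE V ⊤ h) := by
  subst hV
  rw [Hom.appLE]
  have := j.isIso_app j.opensRange le_rfl
  have : ⊤ = j ⁻¹ᵁ j.opensRange := by simp
  have : IsIso (homOfLE h) := ⟨eqToHom this.symm, rfl, rfl⟩
  infer_instance

lemma exists_appLE_eq {X Z : Scheme.{u}} {R : CommRingCat.{u}} {W : X.Opens} (φ : R ⟶ Γ(X, W))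
    (j : Spec R ⟶ Z) [IsOpenImmersion j] {g : X ⟶ Z} (hg : W.ι ≫ g = W.toSpecΓ ≫ Spec.map φ ≫ j)
    {V : Z.Opens} (hV : V = j.opensRange) (h : W ≤ g ⁻¹ᵁ V) :
    ∃ e : Γ(Z, V) ≅ R, g.appLE V W h = e.hom ≫ φ := by
  have hj : ⊤ ≤ j ⁻¹ᵁ V := by rw [hV]; simp
  have := isIso_appLE_of_eq_opensRange j hV hj
  refine ⟨asIso (j.appLE V ⊤ hj) ≪≫ ΓSpecIso R, ?_⟩
  have hW : ⊤ ≤ W.ι ⁻¹ᵁ W := by simp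
  have hι : IsIso (W.ι.appLE W ⊤ hW) := isIso_appLE_of_eq_opensRange _ (by simp) _
  have htop : (⊤ : W.toScheme.Opens) ≤ (W.toSpecΓ ≫ Spec.map φ) ⁻¹ᵁ ⊤ := le_rfl
  have hφ : (W.toSpecΓ ≫ Spec.map φ).appLE ⊤ ⊤ htop =
      (ΓSpecIso R).hom ≫ φ ≫ W.ι.appLE W ⊤ hW := by
    refine (Hom.app_eq_appLE _).symm.trans ?_
    have hΓ : W.toSpecΓ.appTop = (ΓSpecIso Γ(X, W)).hom ≫ W.ι.appLE W ⊤ hW := by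
      rw [Opens.toSpecΓ_appTop, Opens.ι_appLE]
      rfl
    exact congr((Spec.map φ).appTop ≫ $hΓ).trans (ΓSpecIso_naturality_assoc φ _)
  rw [← cancel_mono (W.ι.appLE W ⊤ hW), Scheme.Hom.appLE_comp_appLE]
  simp only [Iso.trans_hom, asIso_hom, Category.assoc, ← hφ]
  rw [Scheme.Hom.appLE_comp_appLE]
  simp only [hg, Category.assoc]

/-- A quasi-coherent `O_Y`-subalgebra of `f_* O_X`, given by its sections on the affine open subsets
of `Y`. The field `exists_pow_mul_mem` expresses quasi-coherence. -/
structure QCohSubalgebra {X Y : Scheme.{u}} (f : X ⟶ Y) where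
  obj (U : Y.AffineZariskiSite) : Subring Γ(X, f ⁻¹ᵁ U.toOpens)
  app_mem (U) (t : Γ(Y, U.toOpens)) : f.app U.toOpens t ∈ obj U
  res_mem {U V} (h : V ≤ U) {s : Γ(X, f ⁻¹ᵁ U.toOpens)} (hs : s ∈ obj U) :
    X.presheaf.map (homOfLE (f.preimage_mono (toOpens_mono h))).op s ∈ obj V
  exists_pow_mul_mem (U) (t : Γ(Y, U.toOpens)) (s : Γ(X, f ⁻¹ᵁ U.toOpens))
    (hs : X.presheaf.map (homOfLE (f.preimage_mono (toOpens_mono (U.basicOpen_le t)))).op s ∈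
      obj (U.basicOpen t)) :
    ∃ n : ℕ, f.app U.toOpens t ^ n * s ∈ obj U

namespace QCohSubalgebra

variable {X Y : Scheme.{u}} {f : X ⟶ Y} (A : QCohSubalgebra f)

/-- The subalgebra as a functor on the affine open subsets of `Y`. -/
def diagram : Y.AffineZariskiSiteᵒᵖ ⥤ CommRingCat where
  obj U := .of (A.obj U.unop)
  map i :=
    CommRingCat.ofHom ((X.presheaf.map
      (homOfLE (f.preimage_mono (toOpens_mono i.unop.le))).op).hom.restrict
      _ _ fun _ hx ↦ A.res_mem i.unop.le hx)
  map_id _ := CommRingCat.hom_ext <| RingHom.ext fun s ↦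
    Subtype.ext congr($(X.presheaf.map_id _) s.1)
  map_comp i j := CommRingCat.hom_ext <| RingHom.ext fun s ↦
    Subtype.ext congr($(X.presheaf.map_comp
      (homOfLE (f.preimage_mono (toOpens_mono i.unop.le))).op
      (homOfLE (f.preimage_mono (toOpens_mono j.unop.le))).op) s.1)

/-- The structure map `O_Y → A` of the subalgebra `A`. -/
def diagramMap : (toOpensFunctor Y).op ⋙ Y.presheaf ⟶ A.diagram where
  app U := CommRingCat.ofHom
    ((f.app U.unop.toOpens).hom.codRestrict (A.obj U.unop) (A.app_mem U.unop))
  naturality _ _ i := CommRingCat.hom_ext <| RingHom.ext fun s ↦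
    Subtype.ext congr($(f.naturality ((toOpensFunctor Y).op.map i)) s)

variable [QuasiCompact f] [QuasiSeparated f]

lemma coequifibered_diagramMap : A.diagramMap.Coequifibered := by
  refine coequifibered_iff_forall_isLocalizationAway.mpr fun U t ↦ ?_
  refine isLocalization_away_restrict
    (X.presheaf.map (homOfLE (f.preimage_mono (Y.basicOpen_le t))).op).hom
    (A' := A.obj (U.basicOpen t)) (fun _ ↦ A.res_mem (U.basicOpen_le t)) ⟨_, A.app_mem U t⟩
    (isLocalization_away_preimage_basicOpen f U.2 t) ?_ (A.exists_pow_mul_mem U t)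
  have := (Y.toRingedSpace.isUnit_res_basicOpen t).map (A.diagramMap.app (.op (U.basicOpen t))).hom
  convert! this
  exact congr($(A.diagramMap.naturality (homOfLE (U.basicOpen_le t)).op) t).symm

/-- The spectra of the rings of sections of `A`, as data to be glued over the affine open cover
of `Y`. -/
def glueData : (directedCover Y).RelativeGluingData := relativeGluingData A.coequifibered_diagramMap

instance : (A.glueData.functor ⋙ Scheme.forget).IsLocallyDirected :=
  Cover.RelativeGluingData.instIsLocallyDirectedI₀CompFunctorForgetOfIsThin ..

/-- The relative spectrum of `A` over `Y`. -/
def spec : Scheme.{u} := A.glueData.glued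

/-- The preimage of the affine open subset `U` of `Y` in the relative spectrum, as an affine
scheme. -/
def chart (U : Y.AffineZariskiSite) : Spec (A.diagram.obj (.op U)) ⟶ A.spec :=
  Limits.colimit.ι A.glueData.functor U

instance (U : Y.AffineZariskiSite) : IsOpenImmersion (A.chart U) := A.glueData.cover.map_prop U

/-- The structure morphism of the relative spectrum. -/
def specHom : A.spec ⟶ Y := A.glueData.toBase

lemma chart_specHom (U : Y.AffineZariskiSite) : A.chart U ≫ A.specHom =
    Spec.map (A.diagramMap.app (.op U)) ≫ U.2.fromSpec :=
  Limits.colimit.ι_desc _ _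

lemma specHom_preimage (U : Y.AffineZariskiSite) :
    A.specHom ⁻¹ᵁ U.toOpens = (A.chart U).opensRange := by
  simpa using! A.glueData.toBase_preimage_eq_opensRange_ι U

instance : IsAffineHom A.specHom where
  isAffine_preimage U hU := by
    rw [A.specHom_preimage ⟨U, hU⟩]
    exact isAffineOpen_opensRange (A.chart (show Y.AffineZariskiSite from ⟨U, hU⟩))

/-- The inclusion of `A` in `f_* O_X` on an affine open subset of `Y`. -/
def incl (U : Y.AffineZariskiSite) : A.diagram.obj (.op U) ⟶ Γ(X, f ⁻¹ᵁ U.toOpens) :=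
  CommRingCat.ofHom (A.obj U).subtype

/-- The restriction of the canonical morphism from `X` to the relative spectrum of `A` to the
preimage of an affine open subset of `Y`. -/
def toChart (U : Y.AffineZariskiSite) : (f ⁻¹ᵁ U.toOpens).toScheme ⟶ A.spec :=
  (f ⁻¹ᵁ U.toOpens).toSpecΓ ≫ Spec.map (A.incl U) ≫ A.chart U

lemma homOfLE_toChart {U V : Y.AffineZariskiSite} (i : U ⟶ V) :
    X.homOfLE (f.preimage_mono (toOpens_mono i.le)) ≫ A.toChart V = A.toChart U := by
  have hchart : Spec.map (A.diagram.map i.op) ≫ A.chart V = A.chart U :=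
    Limits.colimit.w A.glueData.functor i
  dsimp only [toChart]
  rw [← hchart, ← Scheme.Opens.toSpecΓ_SpecMap_presheaf_map_assoc,
    ← Spec.map_comp_assoc, ← Spec.map_comp_assoc]
  rfl

lemma exists_toSpec : ∃ g : X ⟶ A.spec, ∀ U, (f ⁻¹ᵁ U.toOpens).ι ≫ g = A.toChart U :=
  exists_hom_of_affine_cover f A.toChart fun _ _ ↦ A.homOfLE_toChart

/-- The canonical morphism from `X` to the relative spectrum of `A`. -/
def toSpec : X ⟶ A.spec := A.exists_toSpec.choose

lemma ι_toSpec (U : Y.AffineZariskiSite) : (f ⁻¹ᵁ U.toOpens).ι ≫ A.toSpec = A.toChart U :=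
  A.exists_toSpec.choose_spec U

lemma toChart_specHom (U : Y.AffineZariskiSite) :
    A.toChart U ≫ A.specHom = (f ⁻¹ᵁ U.toOpens).ι ≫ f := by
  have hU : IsAffineOpen U.toOpens := U.2
  have happ : Spec.map (A.incl U) ≫ Spec.map (A.diagramMap.app (op U)) =
      Spec.map (f.app U.toOpens) := (Spec.map_comp _ _).symm
  calc A.toChart U ≫ A.specHom
    _ = (f ⁻¹ᵁ U.toOpens).toSpecΓ ≫ Spec.map (A.incl U) ≫ A.chart U ≫ A.specHom := by
      simp only [toChart, Category.assoc]
    _ = (f ⁻¹ᵁ U.toOpens).toSpecΓ ≫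
        (Spec.map (A.incl U) ≫ Spec.map (A.diagramMap.app (op U))) ≫ hU.fromSpec :=
      congr((f ⁻¹ᵁ U.toOpens).toSpecΓ ≫ Spec.map (A.incl U) ≫ $(A.chart_specHom U))
    _ = (f ⁻¹ᵁ U.toOpens).ι ≫ f := by
      rw [happ]
      exact toSpecΓ_SpecMap_app_fromSpec f hU

lemma toSpec_specHom : A.toSpec ≫ A.specHom = f := by
  refine Scheme.Cover.hom_ext (X.openCoverOfIsOpenCover _
    (.comap (iSup_affineOpens_eq_top Y) f.base.1)) _ _ fun U ↦ ?_
  exact ((A.ι_toSpec U) =≫ A.specHom).trans (A.toChart_specHom U)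

lemma preimage_le (U : Y.AffineZariskiSite) :
    f ⁻¹ᵁ U.toOpens ≤ A.toSpec ⁻¹ᵁ A.specHom ⁻¹ᵁ U.toOpens :=
  (congr($A.toSpec_specHom ⁻¹ᵁ U.toOpens)).ge

lemma exists_appLE_toSpec (U : Y.AffineZariskiSite) :
    ∃ e : Γ(A.spec, A.specHom ⁻¹ᵁ U.toOpens) ≅ A.diagram.obj (.op U),
      A.toSpec.appLE _ _ (A.preimage_le U) = e.hom ≫ A.incl U :=
  exists_appLE_eq (A.incl U) (A.chart U) (A.ι_toSpec U) (A.specHom_preimage U) (A.preimage_le U)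

lemma range_appLE_toSpec (U : Y.AffineZariskiSite) :
    Set.range (A.toSpec.appLE _ _ (A.preimage_le U)) = A.obj U := by
  obtain ⟨e, he⟩ := A.exists_appLE_toSpec U
  rw [he]
  exact ((ConcreteCategory.bijective_of_isIso e.hom).2.range_comp _).trans Subtype.range_val

end QCohSubalgebra

namespace QCohSubalgebra
variable {X Y : Scheme.{u}} {f : X ⟶ Y} (A : QCohSubalgebra f)

lemma surjective_toChart [IsIntegralHom f] (U : Y.AffineZariskiSite) {z : A.spec}
    (hz : z ∈ A.specHom ⁻¹ᵁ U.toOpens) : ∃ x, A.toChart U x = z := by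
  have hU : IsAffineOpen (f ⁻¹ᵁ U.toOpens) := U.2.preimage f
  have hincl : Surjective (Spec.map (A.incl U)) := by
    refine ⟨RingHom.IsIntegral.comap_surjective ?_ ?_⟩
    · exact .tower_top (A.diagramMap.app (op U)).hom _ (f.isIntegral_app U.toOpens U.2)
    · exact Subtype.val_injective
  have hΓ : IsIso (f ⁻¹ᵁ U.toOpens).toSpecΓ := hU.isoSpec_hom ▸ inferInstance
  rw [A.specHom_preimage] at hz
  obtain ⟨q, rfl⟩ := hz
  obtain ⟨x, rfl⟩ := ((f ⁻¹ᵁ U.toOpens).toSpecΓ ≫ Spec.map (A.incl U)).surjective q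
  exact ⟨x, rfl⟩

lemma surjective_toSpec [IsIntegralHom f] : Surjective A.toSpec where
  surj z := by
    obtain ⟨U, hU, hzU, -⟩ := exists_isAffineOpen_mem_and_subset (Opens.mem_top (A.specHom z))
    obtain ⟨x, rfl⟩ := A.surjective_toChart ⟨U, hU⟩ hzU
    exact ⟨x.1, congr($(A.ι_toSpec ⟨U, hU⟩) x)⟩

instance isReduced_spec [QuasiCompact f] [QuasiSeparated f] [IsReduced X] : IsReduced A.spec := by
  have (U : A.glueData.cover.I₀) : IsReduced (A.glueData.cover.X U) := by
    change IsReduced (Spec (.of (A.obj U)))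
    have : _root_.IsReduced (A.obj U) :=
      isReduced_of_injective (A.obj U).subtype Subtype.val_injective
    infer_instance
  exact .of_openCover _ A.glueData.cover

end QCohSubalgebra

section

variable {X Y : Scheme.{u}} [IsIntegral X]

/-- The functions on `U` that lie in `M` as rational functions. All functions qualify on the empty
set. -/
def sectionsIn (M : Subring X.functionField) (U : X.Opens) : Subring Γ(X, U) :=
  ⨅ h : genericPoint X ∈ U, M.comap (X.presheaf.germ U (genericPoint X) h).hom

lemma mem_sectionsIn {M : Subring X.functionField} {U : X.Opens} {s : Γ(X, U)} :
    s ∈ sectionsIn M U ↔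
      ∀ h : genericPoint X ∈ U, X.presheaf.germ U (genericPoint X) h s ∈ M := by
  simp [sectionsIn, Subring.mem_iInf]

variable [IsIntegral Y]

lemma functionFieldMap_germToFunctionField (f : X ⟶ Y) (hf : Surjective f) (U : Y.Opens)
    [Nonempty U] [Nonempty (f ⁻¹ᵁ U : X.Opens)] (t : Γ(Y, U)) :
    functionFieldMap f hf (Y.germToFunctionField U t) =
      X.germToFunctionField (f ⁻¹ᵁ U) (f.app U t) := by
  simp only [functionFieldMap, CommRingCat.hom_comp, RingHom.comp_apply]
  erw [TopCat.Presheaf.germ_stalkSpecializes_apply]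
  exact Scheme.Hom.germ_stalkMap_apply f U _ _ t

/-- The subalgebra of `f_* O_X` of the functions that lie in `M ⊇ k(Y)` as rational functions: its
relative spectrum is the normalisation of `Y` in `M` if `X` is normal and `M` is a field. -/
def rationalSubalgebra (f : X ⟶ Y) (hf : Surjective f) (M : Subring X.functionField)
    (hM : (functionFieldMap f hf).range ≤ M) : QCohSubalgebra f where
  obj U := sectionsIn M (f ⁻¹ᵁ U.toOpens)
  app_mem U t := mem_sectionsIn.mpr fun h ↦ by
    have hU : genericPoint Y ∈ U.toOpens := map_genericPoint f hf ▸ h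
    have : Nonempty U.toOpens := ⟨⟨_, hU⟩⟩
    have : Nonempty (f ⁻¹ᵁ U.toOpens : X.Opens) := ⟨⟨_, h⟩⟩
    exact hM ⟨_, functionFieldMap_germToFunctionField f hf U.toOpens t⟩
  res_mem h s hs := mem_sectionsIn.mpr fun hV ↦ by
    rw [TopCat.Presheaf.germ_res_apply]
    exact mem_sectionsIn.mp hs _
  exists_pow_mul_mem U t s hs := by
    by_cases ht : genericPoint X ∈ f ⁻¹ᵁ (U.basicOpen t).toOpens
    · refine ⟨0, mem_sectionsIn.mpr fun _ ↦ ?_⟩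
      have := mem_sectionsIn.mp hs ht
      rwa [TopCat.Presheaf.germ_res_apply, ← one_mul s, ← pow_zero (f.app U.toOpens t)] at this
    · refine ⟨1, ?_⟩
      have h0 : f.app U.toOpens t = 0 := by
        rw [← basicOpen_eq_bot_iff, ← Hom.preimage_basicOpen, ← Opens.not_nonempty_iff_eq_bot]
        exact fun hne ↦ ht (((genericPoint_spec X).mem_open_set_iff (f ⁻¹ᵁ _).isOpen).mpr
          (by simpa using hne))
      rw [h0, pow_one, zero_mul]
      exact zero_mem _

end

lemma nonempty_preimage {X Y : Scheme.{u}} (f : X ⟶ Y) (hf : Surjective f) (U : Y.Opens)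
    [hU : Nonempty U] : Nonempty (f ⁻¹ᵁ U : X.Opens) := by
  obtain ⟨y, hy⟩ := hU
  obtain ⟨x, rfl⟩ := hf.surj y
  exact ⟨⟨x, hy⟩⟩

lemma app_injective_of_surjective {X Y : Scheme.{u}} [IsReduced Y] (f : X ⟶ Y) [QuasiCompact f]
    [Surjective f] (U : Y.Opens) : Function.Injective (f.app U) :=
  have := IsSchemeTheoreticallyDominant.of_isDominant f
  f.app_injective U

section

variable {X Y Z : Scheme.{u}} [IsIntegral X] [IsIntegral Y]

lemma functionFieldMap_comp [IsIntegral Z] (f : X ⟶ Y) (hf : Surjective f)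
    (g : Y ⟶ Z) (hg : Surjective g) (hfg : Surjective (f ≫ g)) (z : Z.functionField) :
    functionFieldMap (f ≫ g) hfg z = functionFieldMap f hf (functionFieldMap g hg z) := by
  obtain ⟨U, hU, t, rfl⟩ := Z.presheaf.exists_germ_eq z
  have : Nonempty U := ⟨⟨_, hU⟩⟩
  have := nonempty_preimage g hg U
  have := nonempty_preimage f hf (g ⁻¹ᵁ U)
  have : Nonempty ((f ≫ g) ⁻¹ᵁ U : X.Opens) := this
  calc functionFieldMap (f ≫ g) hfg (Z.germToFunctionField U t)
    _ = X.germToFunctionField ((f ≫ g) ⁻¹ᵁ U) ((f ≫ g).app U t) :=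
      functionFieldMap_germToFunctionField (f ≫ g) hfg U t
    _ = functionFieldMap f hf (Y.germToFunctionField (g ⁻¹ᵁ U) (g.app U t)) := by
      rw [functionFieldMap_germToFunctionField f hf, Scheme.Hom.comp_app]
      rfl
    _ = functionFieldMap f hf (functionFieldMap g hg (Z.germToFunctionField U t)) :=
      congrArg (functionFieldMap f hf) (functionFieldMap_germToFunctionField g hg U t).symm

lemma exists_intermediate (f : X ⟶ Y) [IsIntegralHom f] (hf : Surjective f)
    (M : Subring X.functionField) (hM : (functionFieldMap f hf).range ≤ M) :
    ∃ (Z : Scheme.{u}) (_ : IsIntegral Z) (g : X ⟶ Z) (h : Z ⟶ Y), g ≫ h = f ∧ Surjective g ∧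
      IsAffineHom h ∧ ∀ U : Y.Opens, IsAffineOpen U →
        Set.range (g.app (h ⁻¹ᵁ U)) = sectionsIn M (g ⁻¹ᵁ h ⁻¹ᵁ U) := by
  let A := rationalSubalgebra f hf M hM
  have hsurj : Surjective A.toSpec := A.surjective_toSpec
  have : IrreducibleSpace A.spec := A.toSpec.surjective.irreducibleSpace A.toSpec.continuous
  refine ⟨A.spec, isIntegral_of_irreducibleSpace_of_isReduced _, A.toSpec, A.specHom,
    A.toSpec_specHom, hsurj, inferInstance, fun U hU ↦ ?_⟩
  have hrange (W : X.Opens) (hW : W = f ⁻¹ᵁ U) (h : W ≤ A.toSpec ⁻¹ᵁ A.specHom ⁻¹ᵁ U) :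
      Set.range (A.toSpec.appLE _ W h) = sectionsIn M W := by
    subst hW
    exact A.range_appLE_toSpec ⟨U, hU⟩
  rw [Hom.app_eq_appLE]
  exact hrange _ congr($A.toSpec_specHom ⁻¹ᵁ U) le_rfl

lemma exists_mul_functionFieldMap_eq_germ (f : X ⟶ Y) [IsIntegralHom f] (hf : Surjective f)
    {U : Y.Opens} (hU : IsAffineOpen U) [Nonempty U] [Nonempty (f ⁻¹ᵁ U : X.Opens)]
    (x : X.functionField) :
    ∃ (s : Γ(X, f ⁻¹ᵁ U)) (t : Γ(Y, U)), t ≠ 0 ∧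
      x * functionFieldMap f hf (Y.germToFunctionField U t) =
        X.germToFunctionField (f ⁻¹ᵁ U) s := by
  have := functionField_isFractionRing_of_isAffineOpen X _ (hU.preimage f)
  obtain ⟨a, b, hb, rfl⟩ := IsFractionRing.div_surjective (A := Γ(X, f ⁻¹ᵁ U)) x
  let := (f.app U).hom.toAlgebra
  have : Algebra.IsIntegral Γ(Y, U) Γ(X, f ⁻¹ᵁ U) := ⟨f.isIntegral_app U hU⟩
  have : FaithfulSMul Γ(Y, U) Γ(X, f ⁻¹ᵁ U) :=
    (faithfulSMul_iff_algebraMap_injective _ _).mpr (app_injective_of_surjective f U)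
  obtain ⟨s, t, ht, hst⟩ :=
    Algebra.IsAlgebraic.exists_smul_eq_mul Γ(Y, U) a (nonZeroDivisors.ne_zero hb)
  refine ⟨s, t, ht, ?_⟩
  have hb' := IsFractionRing.to_map_ne_zero_of_mem_nonZeroDivisors (K := X.functionField) hb
  rw [functionFieldMap_germToFunctionField, div_mul_eq_mul_div, div_eq_iff hb', mul_comm]
  have := congr(X.germToFunctionField (f ⁻¹ᵁ U) $hst)
  rwa [Algebra.smul_def, map_mul, map_mul, mul_comm (X.germToFunctionField _ b)] at this

variable [IsIntegral Z]

lemma fieldRange_functionFieldMap_eq (g : X ⟶ Z) (h : Z ⟶ Y) [IsIntegralHom (g ≫ h)] [IsAffineHom h]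
    (hg : Surjective g) (hh : Surjective h) (M : Subfield X.functionField)
    (hM : (functionFieldMap (g ≫ h) inferInstance).fieldRange ≤ M)
    (hrange : ∀ U : Y.Opens, IsAffineOpen U →
        Set.range (g.app (h ⁻¹ᵁ U)) = sectionsIn M.toSubring (g ⁻¹ᵁ h ⁻¹ᵁ U)) :
    (functionFieldMap g hg).fieldRange = M := by
  obtain ⟨U, hU, hyU, -⟩ := exists_isAffineOpen_mem_and_subset (Opens.mem_top (genericPoint Y))
  have : Nonempty U := ⟨⟨_, hyU⟩⟩
  have := nonempty_preimage h hh U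
  have := nonempty_preimage g hg (h ⁻¹ᵁ U)
  have := functionField_isFractionRing_of_isAffineOpen Z _ (hU.preimage h)
  apply le_antisymm
  · rintro _ ⟨z, rfl⟩
    obtain ⟨c, d, -, rfl⟩ := IsFractionRing.div_surjective (A := Γ(Z, h ⁻¹ᵁ U)) z
    have hmem (c : Γ(Z, h ⁻¹ᵁ U)) : functionFieldMap g hg (Z.germToFunctionField _ c) ∈ M := by
      rw [functionFieldMap_germToFunctionField]
      exact mem_sectionsIn.mp ((hrange U hU).le ⟨c, rfl⟩) _
    rw [map_div₀]
    exact div_mem (hmem c) (hmem d)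
  · intro m hm
    have : Nonempty ((g ≫ h) ⁻¹ᵁ U : X.Opens) := ‹Nonempty (g ⁻¹ᵁ h ⁻¹ᵁ U : X.Opens)›
    obtain ⟨s, t, ht, hst⟩ := exists_mul_functionFieldMap_eq_germ (g ≫ h) inferInstance hU m
    have hs : s ∈ sectionsIn M.toSubring (g ⁻¹ᵁ h ⁻¹ᵁ U) := mem_sectionsIn.mpr fun hη ↦
      show _ ∈ M from hst ▸ mul_mem hm (hM ⟨_, rfl⟩)
    obtain ⟨s, rfl⟩ := (hrange U hU).ge hs
    have ht0 : functionFieldMap (g ≫ h) inferInstance (Y.germToFunctionField U t) ≠ 0 :=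
      (map_ne_zero _).mpr ((map_ne_zero_iff _ (Y.germToFunctionField_injective U)).mpr ht)
    rw [← eq_div_iff ht0] at hst
    rw [hst]
    exact div_mem ⟨Z.germToFunctionField _ s, functionFieldMap_germToFunctionField g hg _ s⟩
      ⟨functionFieldMap h hh _, (functionFieldMap_comp g hg h hh _ _).symm⟩

end

/-! ### Intermediate normal varieties -/

lemma isFinite_of_comp {X Y Z : Scheme.{u}} (g : X ⟶ Z) (h : Z ⟶ Y) [IsAffineHom h]
    [IsFinite (g ≫ h)] [Surjective g] [IsReduced Z] [IsLocallyNoetherian Y] : IsFinite h := by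
  have : IsFinite g := .of_comp g h
  refine { finite_app := fun U hU ↦ ?_ }
  have := IsLocallyNoetherian.component_noetherian ⟨U, hU⟩
  have hfin : ((g.app (h ⁻¹ᵁ U)).hom.comp (h.app U).hom).Finite := by
    simpa only [Hom.comp_app, CommRingCat.hom_comp] using! (g ≫ h).finite_app U hU
  algebraize [(h.app U).hom, (g.app (h ⁻¹ᵁ U)).hom, (g.app (h ⁻¹ᵁ U)).hom.comp (h.app U).hom]
  exact Module.Finite.of_injective
    (IsScalarTower.toAlgHom Γ(Y, U) Γ(Z, h ⁻¹ᵁ U) Γ(X, g ⁻¹ᵁ h ⁻¹ᵁ U)).toLinearMap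
    (app_injective_of_surjective g _)

section

variable {X Y Z : Scheme.{u}} [IsIntegral X] [IsIntegral Y] [IsIntegral Z]

lemma germToFunctionField_map {U V : X.Opens} (h : V ≤ U) [Nonempty U] [Nonempty V]
    (s : Γ(X, U)) : X.germToFunctionField V (X.presheaf.map (homOfLE h).op s) =
      X.germToFunctionField U s :=
  X.presheaf.germ_res_apply (homOfLE h) _ _ s

lemma exists_germToFunctionField_eq_of_local (U : X.Opens) [hU : Nonempty U] (x : X.functionField)
    (h : ∀ y ∈ U, ∃ (V : X.Opens) (_ : Nonempty V) (s : Γ(X, V)),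
      y ∈ V ∧ X.germToFunctionField V s = x) :
    ∃ s : Γ(X, U), X.germToFunctionField U s = x := by
  choose V hV s hy hs using h
  let W (y : U) : X.Opens := V y y.2 ⊓ U
  have hW (y : U) : Nonempty (W y) := ⟨⟨y.1, hy y y.2, y.2⟩⟩
  let r (y : U) : Γ(X, W y) := X.presheaf.map (homOfLE inf_le_left).op (s y y.2)
  have hr (y : U) : X.germToFunctionField (W y) (r y) = x :=
    (germToFunctionField_map _ _).trans (hs y y.2)
  have hcompat : TopCat.Presheaf.IsCompatible X.sheaf.obj W r := by
    intro y z
    have hη (y : U) : genericPoint X ∈ W y :=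
      ((genericPoint_spec X).mem_open_set_iff (W y).isOpen).mpr (by simpa using hW y)
    have : Nonempty (W y ⊓ W z : X.Opens) := ⟨⟨genericPoint X, hη y, hη z⟩⟩
    apply X.germToFunctionField_injective (W y ⊓ W z)
    exact ((germToFunctionField_map inf_le_left (r y)).trans (hr y)).trans
      ((germToFunctionField_map inf_le_right (r z)).trans (hr z)).symm
  obtain ⟨t, ht, -⟩ := X.sheaf.existsUnique_gluing' W U (fun _ ↦ homOfLE inf_le_right)
    (fun y hyU ↦ Opens.mem_iSup.mpr ⟨⟨y, hyU⟩, hy y hyU, hyU⟩) r hcompat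
  let y : U := hU.some
  refine ⟨t, ?_⟩
  rw [← hr y, ← ht y]
  exact (germToFunctionField_map inf_le_right t).symm

lemma exists_germToFunctionField_eq_of_isIntegral
    (hX : ∀ x : X, IsIntegrallyClosed (X.presheaf.stalk x)) {U : X.Opens} [Nonempty U]
    {x : X.functionField} (hx : _root_.IsIntegral Γ(X, U) x) :
    ∃ s : Γ(X, U), X.germToFunctionField U s = x := by
  refine exists_germToFunctionField_eq_of_local U x fun y hyU ↦ ?_
  let := TopCat.Presheaf.algebra_section_stalk X.presheaf (⟨y, hyU⟩ : U)
  have := functionField_isScalarTower X U ⟨y, hyU⟩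
  have hxy : _root_.IsIntegral (X.presheaf.stalk y) x :=
    IsIntegral.tower_top (R := Γ(X, U)) (A := X.presheaf.stalk (⟨y, hyU⟩ : U).1) hx
  have := hX y
  obtain ⟨a, rfl⟩ := IsIntegrallyClosed.algebraMap_eq_of_integral hxy
  obtain ⟨W, hyW, s, rfl⟩ := X.presheaf.exists_germ_eq a
  have : Nonempty W := ⟨⟨y, hyW⟩⟩
  exact ⟨W, inferInstance, s, hyW, (X.algebraMap_germ_eq_germToFunctionField hyW s).symm⟩

lemma isIntegral_of_functionFieldMap_eq (f : X ⟶ Y) [IsIntegralHom f] (hf : Surjective f)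
    {U : Y.Opens} (hU : IsAffineOpen U) [Nonempty U] [Nonempty (f ⁻¹ᵁ U : X.Opens)]
    {l : Y.functionField} {s : Γ(X, f ⁻¹ᵁ U)}
    (h : functionFieldMap f hf l = X.germToFunctionField (f ⁻¹ᵁ U) s) :
    _root_.IsIntegral Γ(Y, U) l := by
  obtain ⟨q, hq, hqs⟩ := f.isIntegral_app U hU s
  refine ⟨q, hq, (functionFieldMap f hf).injective ?_⟩
  have hcomp : (functionFieldMap f hf).comp (algebraMap Γ(Y, U) Y.functionField) =
      (X.germToFunctionField (f ⁻¹ᵁ U)).hom.comp (f.app U).hom :=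
    RingHom.ext (functionFieldMap_germToFunctionField f hf U)
  rw [Polynomial.hom_eval₂, hcomp, h, map_zero]
  refine (Polynomial.hom_eval₂ _ _ _ _).symm.trans ?_
  rw [hqs, map_zero]

lemma mem_range_app_of_germ_mem_range (f : X ⟶ Y) [IsIntegralHom f] (hf : Surjective f)
    (hY : ∀ y : Y, IsIntegrallyClosed (Y.presheaf.stalk y)) (V : Y.Opens) [Nonempty V]
    [Nonempty (f ⁻¹ᵁ V : X.Opens)] (s : Γ(X, f ⁻¹ᵁ V))
    (hs : X.germToFunctionField (f ⁻¹ᵁ V) s ∈ (functionFieldMap f hf).range) :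
    s ∈ Set.range (f.app V) := by
  obtain ⟨l, hl⟩ := hs
  obtain ⟨t, rfl⟩ : ∃ t : Γ(Y, V), Y.germToFunctionField V t = l := by
    refine exists_germToFunctionField_eq_of_local V l fun y hy ↦ ?_
    obtain ⟨W, hW, hyW, hWV⟩ := exists_isAffineOpen_mem_and_subset hy
    have : Nonempty W := ⟨⟨y, hyW⟩⟩
    have := nonempty_preimage f hf W
    rw [← germToFunctionField_map (f.preimage_mono hWV) s] at hl
    obtain ⟨t, ht⟩ := exists_germToFunctionField_eq_of_isIntegral hY
      (isIntegral_of_functionFieldMap_eq f hf hW hl)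
    exact ⟨W, inferInstance, t, hyW, ht⟩
  refine ⟨t, X.germToFunctionField_injective (f ⁻¹ᵁ V) ?_⟩
  rw [← functionFieldMap_germToFunctionField f hf, hl]

lemma isIntegrallyClosed_stalk_of_isAffineOpen {U : X.Opens} (hU : IsAffineOpen U)
    [IsIntegrallyClosed Γ(X, U)] {x : X} (hx : x ∈ U) :
    IsIntegrallyClosed (X.presheaf.stalk x) := by
  have : Nonempty U := ⟨⟨x, hx⟩⟩
  let := TopCat.Presheaf.algebra_section_stalk X.presheaf (⟨x, hx⟩ : U)
  have := hU.isLocalization_stalk ⟨x, hx⟩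
  exact isIntegrallyClosed_of_isLocalization _ _ (Ideal.primeCompl_le_nonZeroDivisors
    (hU.primeIdealOf ⟨x, hx⟩).asIdeal)

lemma isIntegrallyClosed_of_range_app_eq (g : X ⟶ Z) (hg : Surjective g)
    (hX : ∀ x : X, IsIntegrallyClosed (X.presheaf.stalk x)) (M : Subring X.functionField)
    (hM : (functionFieldMap g hg).range ≤ M) {V : Z.Opens} (hV : IsAffineOpen V) [Nonempty V]
    (hrange : Set.range (g.app V) = sectionsIn M (g ⁻¹ᵁ V)) :
    IsIntegrallyClosed Γ(Z, V) := by
  have := nonempty_preimage g hg V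
  have := functionField_isFractionRing_of_isAffineOpen Z _ hV
  rw [isIntegrallyClosed_iff Z.functionField]
  intro z hz
  have hz' : _root_.IsIntegral Γ(X, g ⁻¹ᵁ V) (functionFieldMap g hg z) :=
    hz.map_of_comp_eq (g.app V).hom (functionFieldMap g hg)
      (RingHom.ext fun t ↦ (functionFieldMap_germToFunctionField g hg V t).symm)
  obtain ⟨s, hs⟩ := exists_germToFunctionField_eq_of_isIntegral hX hz'
  obtain ⟨t, rfl⟩ := hrange.ge (mem_sectionsIn.mpr fun _ ↦ (hs ▸ hM ⟨z, rfl⟩ :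
    X.germToFunctionField _ s ∈ M))
  exact ⟨t, (functionFieldMap g hg).injective
    ((functionFieldMap_germToFunctionField g hg V t).trans hs)⟩

end

lemma exists_intermediate_normalVariety {k : Type u} [Field k] {X Y : NormalVariety k} (f : X ⟶ Y)
    [hf : Surjective (schemeMap f)] [IsFinite (schemeMap f)] (M : Subfield X.scheme.functionField)
    (hM : (functionFieldMap (schemeMap f) hf).fieldRange ≤ M) :
    ∃ (Z : NormalVariety k) (g : X ⟶ Z) (h : Z ⟶ Y), g ≫ h = f ∧ IsFinite (schemeMap g) ∧
      IsFinite (schemeMap h) ∧ Surjective (schemeMap h) ∧ ∃ hg : Surjective (schemeMap g),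
        (functionFieldMap (schemeMap g) hg).fieldRange = M := by
  have := Y.property.isSeparated
  have := Y.property.locallyOfFiniteType
  have := Y.property.quasiCompact
  have : IsLocallyNoetherian Y.scheme := LocallyOfFiniteType.isLocallyNoetherian Y.obj.hom
  obtain ⟨Z, hZ, g, h, hgh, hg, _, hrange⟩ := exists_intermediate (schemeMap f) hf M.toSubring hM
  have : IsFinite (g ≫ h) := hgh ▸ inferInstance
  have : Surjective (g ≫ h) := hgh ▸ hf
  have hh : Surjective h := .of_comp g h
  have hh' : IsFinite h := isFinite_of_comp g h
  have hgM : (functionFieldMap g hg).fieldRange = M :=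
    fieldRange_functionFieldMap_eq g h hg hh M (by simpa only [hgh] using hM) hrange
  let Z' : NormalVariety k := ⟨Over.mk (h ≫ Y.obj.hom),
    { isIntegral := hZ
      isSeparated := inferInstanceAs (IsSeparated (h ≫ Y.obj.hom))
      locallyOfFiniteType := inferInstanceAs (LocallyOfFiniteType (h ≫ Y.obj.hom))
      quasiCompact := inferInstanceAs (QuasiCompact (h ≫ Y.obj.hom))
      normal := fun z ↦ by
        obtain ⟨U, hU, hzU, -⟩ := exists_isAffineOpen_mem_and_subset (Opens.mem_top (h z))
        have : Nonempty (h ⁻¹ᵁ U : Z.Opens) := ⟨⟨z, hzU⟩⟩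
        have := isIntegrallyClosed_of_range_app_eq g hg X.property.normal M.toSubring hgM.le
          (hU.preimage h) (hrange U hU)
        exact isIntegrallyClosed_stalk_of_isAffineOpen (hU.preimage h) hzU }⟩
  let g' : X ⟶ Z' := ⟨Over.homMk g <|
    (Category.assoc g h _).symm.trans <| congr($hgh ≫ Y.obj.hom).trans (Over.w f.hom)⟩
  exact ⟨Z', g', ⟨Over.homMk h rfl⟩, by ext; exact hgh, .of_comp g h, hh', hh, hg, hgM⟩

/-! ### Factoring the absolute Frobenius -/

section Descent
variable {X Z T : Scheme.{u}}

lemma exists_preimage_eq_of_forall_exists_pow {X Y : Scheme.{u}} (f : X ⟶ Y) [IsAffineHom f]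
    {p : ℕ} (hp : 0 < p) (H : ∀ (V : Y.Opens) (s : Γ(X, f ⁻¹ᵁ V)), s ^ p ∈ (f.app V).hom.range)
    (W : X.Opens) : ∃ V : Y.Opens, f ⁻¹ᵁ V = W := by
  have hloc (x : W) : ∃ V : Y.Opens, x.1 ∈ f ⁻¹ᵁ V ∧ f ⁻¹ᵁ V ≤ W := by
    obtain ⟨U, hU, hxU, -⟩ := exists_isAffineOpen_mem_and_subset (Opens.mem_top (f x.1))
    obtain ⟨s, hs, hxs⟩ := (hU.preimage f).exists_basicOpen_le x hxU
    obtain ⟨t, ht⟩ := H U s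
    have : f ⁻¹ᵁ Y.basicOpen t = X.basicOpen s := by
      rw [f.preimage_basicOpen, ← X.basicOpen_pow s hp]
      exact congrArg (X.basicOpen ·) ht
    exact ⟨Y.basicOpen t, this ▸ hxs, this ▸ hs⟩
  choose V hV hVW using hloc
  refine ⟨⨆ x, V x, le_antisymm ?_ fun x hx ↦ Opens.mem_iSup.mpr ⟨⟨x, hx⟩, hV _⟩⟩
  rw [f.preimage_iSup]
  exact iSup_le hVW

lemma isHomeomorph_of_forall_exists_pow {X Y : Scheme.{u}} (f : X ⟶ Y) [IsAffineHom f]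
    [Surjective f] {p : ℕ} (hp : 0 < p)
    (H : ∀ (V : Y.Opens) (s : Γ(X, f ⁻¹ᵁ V)), s ^ p ∈ (f.app V).hom.range) :
    IsHomeomorph f := by
  have hind : Topology.IsInducing f := ⟨le_antisymm f.continuous.le_induced fun W hW ↦ by
    obtain ⟨V, hV⟩ := exists_preimage_eq_of_forall_exists_pow f hp H ⟨W, hW⟩
    exact ⟨V, V.isOpen, congrArg SetLike.coe hV⟩⟩
  exact (hind.isEmbedding.toHomeomorphOfSurjective f.surjective).isHomeomorph

lemma exists_ringHom_comp_eq {A B C : Type*} [CommRing A] [CommRing B] [CommRing C] {φ : B →+* C}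
    (hφ : Function.Injective φ) {ψ : A →+* C} (h : ψ.range ≤ φ.range) :
    ∃ θ : A →+* B, φ.comp θ = ψ := by
  let e := RingEquiv.ofBijective φ.rangeRestrict
    ⟨fun a b hab ↦ hφ congr(Subtype.val $hab), φ.rangeRestrict_surjective⟩
  refine ⟨e.symm.toRingHom.comp (ψ.codRestrict φ.range fun a ↦ h ⟨a, rfl⟩),
    RingHom.ext fun a ↦ ?_⟩
  exact congr(Subtype.val $(e.apply_symm_apply ⟨ψ a, h ⟨a, rfl⟩⟩))

lemma exists_comp_eq_of_toPshHom_comp_eq (g : X ⟶ Z) [Surjective g] (t : X ⟶ T)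
    (h₀ : Z.toPresheafedSpace ⟶ T.toPresheafedSpace) (hh₀ : g.toPshHom ≫ h₀ = t.toPshHom) :
    ∃ h : Z ⟶ T, g ≫ h = t := by
  refine ⟨⟨h₀, fun z ↦ ?_⟩, ?_⟩
  · obtain ⟨x, rfl⟩ := g.surjective z
    have hloc (x : X) : IsLocalHom ((g.toPshHom ≫ h₀).stalkMap x).hom := hh₀ ▸ t.prop x
    have := hloc x
    rw [PresheafedSpace.stalkMap.comp] at this
    exact @_root_.isLocalHom_of_comp _ _ _ _ _ _ _ (g.toPshHom.stalkMap x).hom this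
  · exact Hom.ext' (LocallyRingedSpace.Hom.ext' hh₀)

lemma exists_comp_eq_of_range_appLE_le (g : X ⟶ Z) [Surjective g]
    (hinj : ∀ V, Function.Injective (g.app V)) (t : X ⟶ T) (e : C(Z, T)) (he : ∀ x, e (g x) = t x)
    (H : ∀ (U : T.Opens) (V : Z.Opens) (h : g ⁻¹ᵁ V ≤ t ⁻¹ᵁ U),
      (t.appLE U (g ⁻¹ᵁ V) h).hom.range ≤ (g.app V).hom.range) :
    ∃ h : Z ⟶ T, g ≫ h = t := by
  let V (U : T.Opens) : Z.Opens := (Opens.map (TopCat.ofHom e)).obj U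
  have hV (U : T.Opens) : g ⁻¹ᵁ V U = t ⁻¹ᵁ U := by
    ext x
    change e (g x) ∈ U ↔ t x ∈ U
    rw [he]
  choose θ hθ using fun U ↦ exists_ringHom_comp_eq (hinj (V U)) (H U (V U) (hV U).le)
  have hθ' (U : T.Opens) : CommRingCat.ofHom (θ U) ≫ g.app (V U) = t.appLE U _ (hV U).le :=
    CommRingCat.hom_ext (hθ U)
  let h₀ : Z.toPresheafedSpace ⟶ T.toPresheafedSpace :=
    { base := TopCat.ofHom e
      c :=
        { app U := CommRingCat.ofHom (θ U.unop)
          naturality U U' i := by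
            have := ConcreteCategory.mono_of_injective _ (hinj (V U'.unop))
            have hnat := g.naturality ((Opens.map (TopCat.ofHom e)).map i.unop).op
            rw [← cancel_mono (g.app (V U'.unop)), Category.assoc, hθ', Hom.map_appLE]
            refine Eq.trans ?_ congr(CommRingCat.ofHom (θ U.unop) ≫ $hnat.symm)
            rw [reassoc_of% (hθ' U.unop)]
            exact (Hom.appLE_map ..).symm } }
  refine exists_comp_eq_of_toPshHom_comp_eq g t h₀ (PresheafedSpace.ext _ _ ?_ ?_)
  · ext x
    exact he x
  · ext U s
    change X.presheaf.map (homOfLE (hV U).ge).op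
      ((CommRingCat.ofHom (θ U) ≫ g.app (V U)) s) = t.app U s
    rw [hθ']
    exact congr($((t.appLE_map (hV U).le (homOfLE (hV U).ge).op).trans t.appLE_eq_app) s)

lemma exists_comp_eq_absoluteFrobenius (g : X ⟶ Z) [IsAffineHom g] [Surjective g]
    (hinj : ∀ V, Function.Injective (g.app V)) {p : ℕ} [hp : Fact p.Prime] (hX : (p : Γ(X, ⊤)) = 0)
    (H : ∀ (V : Z.Opens) (s : Γ(X, g ⁻¹ᵁ V)), s ^ p ∈ (g.app V).hom.range) :
    ∃ h : Z ⟶ X, g ≫ h = absoluteFrobenius p X hX := by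
  let e := (isHomeomorph_of_forall_exists_pow g hp.out.pos H).homeomorph
  refine exists_comp_eq_of_range_appLE_le g hinj _ (e.symm : C(Z, X)) e.symm_apply_apply ?_
  rintro U V hUV _ ⟨s, rfl⟩
  have : (absoluteFrobenius p X hX).appLE U (g ⁻¹ᵁ V) hUV s =
      X.presheaf.map (homOfLE hUV).op s ^ p :=
    map_pow (X.presheaf.map (homOfLE hUV).op).hom s p
  exact this ▸ H V _

end Descent

/-! ### Vector fields and function fields -/

section Foliation
variable {k : Type u} [Field k] {X Y Z : NormalVariety k}

lemma eq_of_nonempty_imp {X : Scheme.{u}} {U : X.Opens} {s t : Γ(X, U)} (h : Nonempty U → s = t) :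
    s = t := by
  by_cases hU : Nonempty U
  · exact h hU
  · obtain rfl : U = ⊥ := by
      ext x
      simpa using fun hx ↦ hU ⟨⟨x, hx⟩⟩
    have := CommRingCat.subsingleton_of_isTerminal X.sheaf.isTerminalOfEmpty
    exact Subsingleton.elim s t

lemma res_res {U V W : X.scheme.Opens} (h : V ≤ U) (h' : W ≤ V) (s : Γ(X.scheme, U)) :
    res h' (res h s) = res (h'.trans h) s :=
  congr($((X.scheme.presheaf.map_comp (homOfLE h).op (homOfLE h').op).symm) s)

lemma res_injective {U V : X.scheme.Opens} (h : V ≤ U) [Nonempty V] :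
    Function.Injective (res h) :=
  map_injective_of_isIntegral X.scheme (homOfLE h)

lemma res_mem_inverseImageSections (f : X ⟶ Y) {U V : X.scheme.Opens}
    (h : V ≤ U) {s : Γ(X.scheme, U)} (hs : s ∈ inverseImageSections f U) :
    res h s ∈ inverseImageSections f V := by
  intro x hx
  obtain ⟨W, t, V', h₁, h₂, hx', hst⟩ := hs x (h hx)
  refine ⟨W, t, V' ⊓ V, inf_le_right, inf_le_left.trans h₂, ⟨hx', hx⟩, ?_⟩
  rw [res_res, ← res_res h₁ inf_le_left, hst, res_res]

lemma TangentSection.iterate_der_eq_zero {U V : X.scheme.Opens} (D : TangentSection X U)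
    {hV : V ≤ U} {n : ℕ} (hn : n ≠ 0) {s : Γ(X.scheme, V)} (hs : D.der V hV s = 0) :
    (D.der V hV)^[n] s = 0 := by
  obtain ⟨n, rfl⟩ := Nat.exists_eq_succ_of_ne_zero hn
  rw [Function.iterate_succ_apply, hs, iterate_map_zero]

/-- The `p`-fold composition of a vector field. -/
def TangentSection.pow (p : ℕ) [hp : Fact p.Prime] [CharP k p] {U : X.scheme.Opens}
    (D : TangentSection X U) : TangentSection X U where
  der V hV := powDerivation (D.der V hV) p (natCast_sections_eq_zero p _ (natCast_eq_zero p X) V)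
  der_constants V hV a := by
    rw [powDerivation_apply, D.iterate_der_eq_zero hp.out.ne_zero (D.der_constants V hV a)]
  der_res V hV W h s := by
    rw [powDerivation_apply, powDerivation_apply]
    exact (Function.Semiconj.iterate_right (fun s ↦ (D.der_res V hV W h s).symm) p s).symm

lemma TangentSection.pow_der (p : ℕ) [Fact p.Prime] [CharP k p] {U : X.scheme.Opens}
    (D : TangentSection X U) (V : X.scheme.Opens) (hV : V ≤ U) (s : Γ(X.scheme, V)) :
    (D.pow p).der V hV s = (D.der V hV)^[p] s :=
  powDerivation_apply _ p (natCast_sections_eq_zero p _ (natCast_eq_zero p X) V) s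

lemma isPClosedFoliation_foliationOf (p : ℕ) [hp : Fact p.Prime] [CharP k p] (f : X ⟶ Y) :
    IsPClosedFoliation p (foliationOf f) where
  zero_mem _ _ _ _ _ := rfl
  add_mem U D hD E hE V hV s hs := by
    change D.der V hV s + E.der V hV s = 0
    rw [hD V hV s hs, hE V hV s hs, add_zero]
  smul_mem U r D hD V hV s hs := by
    change res hV r • D.der V hV s = 0
    rw [hD V hV s hs, smul_zero]
  restrict_mem U D hD V h W hW s hs := hD W (hW.trans h) s hs
  mem_of_local U D hD V hV s hs := eq_of_nonempty_imp fun ⟨x, hxV⟩ ↦ by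
    obtain ⟨V', h, hx, hD'⟩ := hD x (hV hxV)
    have : Nonempty (V' ⊓ V : X.scheme.Opens) := ⟨⟨x, hx, hxV⟩⟩
    apply res_injective (inf_le_right : V' ⊓ V ≤ V)
    rw [map_zero, ← D.der_res]
    exact hD' _ inf_le_left _ (res_mem_inverseImageSections f _ hs)
  saturated U r D hr hD V hV s hs := eq_of_nonempty_imp fun _ ↦
    (mul_eq_zero.mp (hD V hV s hs)).resolve_left fun h ↦
      hr (res_injective hV (h.trans (map_zero _).symm))
  bracket_mem U D hD E hE V hV s hs := by
    change ⁅D.der V hV, E.der V hV⁆ s = 0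
    rw [Derivation.commutator_apply, hD V hV s hs, hE V hV s hs, map_zero, map_zero, sub_zero]
  pow_mem U D hD :=
    ⟨D.pow p, fun V hV s hs ↦ (D.pow_der p V hV s).trans
      (D.iterate_der_eq_zero hp.out.ne_zero (hD V hV s hs)), D.pow_der p⟩

section FunctionField

variable {X : Scheme.{u}} [IsIntegral X]

lemma exists_germToFunctionField_eq_derivation (E : Derivation ℤ X.functionField X.functionField)
    {W : X.Opens} (hW : IsAffineOpen W) [Nonempty W]
    (hE : ∀ a : Γ(X, W), ∃ a' : Γ(X, W), X.germToFunctionField W a' = E (X.germToFunctionField W a))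
    {V : X.Opens} [Nonempty V] (hVW : V ≤ W) (s : Γ(X, V)) :
    ∃ s' : Γ(X, V), X.germToFunctionField V s' = E (X.germToFunctionField V s) := by
  refine exists_germToFunctionField_eq_of_local V _ fun y hy ↦ ?_
  obtain ⟨a, haV, hya⟩ := hW.exists_basicOpen_le ⟨y, hy⟩ (hVW hy)
  have hne : Nonempty (X.basicOpen a) := ⟨⟨y, hya⟩⟩
  let res : Γ(X, W) →+* Γ(X, X.basicOpen a) := (X.presheaf.map (homOfLE (X.basicOpen_le a)).op).hom
  let s₀ := X.presheaf.map (homOfLE haV).op s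
  have hres (r) : X.germToFunctionField _ (res r) = X.germToFunctionField W r :=
    germToFunctionField_map _ r
  have hs₀ : X.germToFunctionField _ s₀ = X.germToFunctionField V s := germToFunctionField_map haV s
  obtain ⟨n, c, hc : res c = res a ^ n * s₀⟩ := exists_eq_pow_mul_of_isAffineOpen X W hW a s₀
  obtain ⟨b', hb'⟩ := hE (a ^ n)
  obtain ⟨c', hc'⟩ := hE c
  obtain ⟨v, hv⟩ : ∃ v, res (a ^ n) * v = 1 := by
    rw [← isUnit_iff_exists_inv, map_pow]
    exact (RingedSpace.isUnit_res_basicOpen X.toRingedSpace a).pow n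
  have hs : X.germToFunctionField W c =
      X.germToFunctionField W (a ^ n) * X.germToFunctionField V s := by
    rw [← hres c, hc, map_mul, hs₀, ← hres (a ^ n), map_pow res]
  have hEs := congrArg E hs
  have hv' := congrArg (X.germToFunctionField (X.basicOpen a)) hv
  rw [map_mul, map_one, hres] at hv'
  rw [E.leibniz, ← hc', ← hb', smul_eq_mul, smul_eq_mul] at hEs
  refine ⟨_, hne, (res c' - s₀ * res b') * v, hya, ?_⟩
  rw [map_mul, map_sub, map_mul, hres, hres, hs₀]
  linear_combination X.germToFunctionField _ v * hEs + E (X.germToFunctionField V s) * hv'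

end FunctionField

lemma exists_tangentSection {W : X.scheme.Opens} (hW : IsAffineOpen W) [Nonempty W]
    (E : Derivation ℤ X.scheme.functionField X.scheme.functionField)
    (hk : ∀ a, E (X.scheme.germToFunctionField W (constants X W a)) = 0)
    (hE : ∀ a : Γ(X.scheme, W), ∃ a' : Γ(X.scheme, W),
      X.scheme.germToFunctionField W a' = E (X.scheme.germToFunctionField W a)) :
    ∃ T : TangentSection X W, ∀ (V : X.scheme.Opens) (hV : V ≤ W) [Nonempty V] (s : Γ(X.scheme, V)),
      X.scheme.germToFunctionField V (T.der V hV s) = E (X.scheme.germToFunctionField V s) := by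
  have hex (V : X.scheme.Opens) (hV : V ≤ W) : ∃ D : Derivation ℤ Γ(X.scheme, V) Γ(X.scheme, V),
      ∀ (_ : Nonempty V) (s : Γ(X.scheme, V)), X.scheme.germToFunctionField V (D s) =
        E (X.scheme.germToFunctionField V s) := by
    by_cases hne : Nonempty V
    · obtain ⟨D, hD⟩ := exists_derivation_restrict (X.scheme.germToFunctionField V).hom
        (X.scheme.germToFunctionField_injective V) E
        (exists_germToFunctionField_eq_derivation E hW hE hV)
      exact ⟨D, fun _ ↦ hD⟩
    · exact ⟨0, fun h ↦ absurd h hne⟩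
  choose D hD using hex
  refine ⟨⟨D, fun V hV a ↦ eq_of_nonempty_imp fun hne ↦ ?_, fun V hV V' h s ↦
    eq_of_nonempty_imp fun hne ↦ ?_⟩, fun V hV hne ↦ hD V hV hne⟩
  · have hVW : constants X V a = res hV (constants X W a) := (res_res le_top hV _).symm
    apply X.scheme.germToFunctionField_injective V
    rw [hD _ _ hne, map_zero, hVW]
    exact (congrArg E (germToFunctionField_map hV _)).trans (hk a)
  · have hV' : Nonempty V := ⟨⟨_, h hne.some.2⟩⟩
    apply X.scheme.germToFunctionField_injective V'
    rw [hD _ _ hne]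
    exact (congrArg E (germToFunctionField_map h s)).trans
      ((hD V hV hV' s).symm.trans (germToFunctionField_map h _).symm)

lemma germToFunctionField_mem_range_of_mem_inverseImageSections (f : X ⟶ Y)
    (hf : Surjective (schemeMap f)) {V : X.scheme.Opens} [hV : Nonempty V] {s : Γ(X.scheme, V)}
    (hs : s ∈ inverseImageSections f V) :
    X.scheme.germToFunctionField V s ∈ (functionFieldMap (schemeMap f) hf).range := by
  obtain ⟨x, hx⟩ := id hV
  obtain ⟨U, t, V', h, h', hx', hst⟩ := hs x hx
  have : Nonempty V' := ⟨⟨x, hx'⟩⟩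
  have : Nonempty (schemeMap f ⁻¹ᵁ U : X.scheme.Opens) := ⟨⟨x, h' hx'⟩⟩
  have : Nonempty U := ⟨⟨_, h' hx'⟩⟩
  have hst' := congrArg (X.scheme.germToFunctionField V') hst
  refine ⟨_, (functionFieldMap_germToFunctionField (schemeMap f) hf U t).trans ?_⟩
  exact (germToFunctionField_map h' _).symm.trans (hst'.symm.trans (germToFunctionField_map h s))

lemma constants_mem_inverseImageSections (f : X ⟶ Y) (V : X.scheme.Opens) (a : k) :
    constants X V a ∈ inverseImageSections f V := by
  have hf : (schemeMap f).app ⊤ (constants Y ⊤ a) = constants X ⊤ a := by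
    have htop (Z : NormalVariety k) : constants Z ⊤ a =
      Z.obj.hom.appTop ((Scheme.ΓSpecIso (CommRingCat.of k)).inv a) :=
        congr($(Z.scheme.presheaf.map_id (op ⊤)) _)
    rw [htop, htop]
    exact congr($(congrArg Scheme.Hom.appTop (Over.w f.hom)) _)
  refine fun x hx ↦ ⟨⊤, constants Y ⊤ a, V, le_rfl, le_top, hx, ?_⟩
  rw [hf]
  exact (res_res _ _ _).trans (res_res _ _ _).symm

lemma exists_mem_foliationOf (f : X ⟶ Y) (hf : Surjective (schemeMap f)) {W : X.scheme.Opens}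
    (hW : IsAffineOpen W) [Nonempty W]
    (E : Derivation ℤ X.scheme.functionField X.scheme.functionField)
    (hY : ∀ l, E (functionFieldMap (schemeMap f) hf l) = 0)
    (hE : ∀ a : Γ(X.scheme, W), ∃ a' : Γ(X.scheme, W),
      X.scheme.germToFunctionField W a' = E (X.scheme.germToFunctionField W a)) :
    ∃ T ∈ foliationOf f W, ∀ s, X.scheme.germToFunctionField W (T.der W le_rfl s) =
      E (X.scheme.germToFunctionField W s) := by
  have hkill {V : X.scheme.Opens} [Nonempty V] {s} (hs : s ∈ inverseImageSections f V) :
      E (X.scheme.germToFunctionField V s) = 0 := by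
    obtain ⟨l, hl⟩ := germToFunctionField_mem_range_of_mem_inverseImageSections f hf hs
    exact hl ▸ hY l
  obtain ⟨T, hT⟩ := exists_tangentSection hW E
    (fun a ↦ hkill (constants_mem_inverseImageSections f W a)) hE
  refine ⟨T, fun V hV s hs ↦ eq_of_nonempty_imp fun _ ↦ ?_, hT W le_rfl⟩
  apply X.scheme.germToFunctionField_injective V
  rw [hT, map_zero, hkill hs]

end Foliation

/-! ### Quotients of height one -/

lemma exists_forall_isInteger_smul_linearMap {A B M K : Type*} [CommSemiring A] [CommRing B]
    [AddCommMonoid M] [CommRing K] [Algebra A B] [Module A M] [Module.Finite A M] [Algebra B K]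
    [Algebra A K] [IsScalarTower A B K] (S : Submonoid B) [IsLocalization S K] (φ : M →ₗ[A] K) :
    ∃ d : S, ∀ m, IsLocalization.IsInteger B (d • φ m) := by
  classical
  obtain ⟨T, hT⟩ := Module.Finite.fg_top (R := A) (M := M)
  obtain ⟨d, hd⟩ := IsLocalization.exist_integer_multiples_of_finset S (T.image φ)
  refine ⟨d, fun m ↦ ?_⟩
  induction (hT ▸ Submodule.mem_top : m ∈ Submodule.span A T) using Submodule.span_induction with
  | mem m hm => exact hd _ (Finset.mem_image_of_mem φ hm)
  | zero => simpa using IsLocalization.isInteger_zero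
  | add m n _ _ hm hn => simpa using IsLocalization.isInteger_add hm hn
  | smul a m _ hm =>
    rw [map_smul, smul_comm, ← algebraMap_smul B a]
    exact IsLocalization.isInteger_smul hm

section

variable {X Y : Scheme.{u}} [IsIntegral X] [IsIntegral Y]

lemma finite_functionFieldMap (f : X ⟶ Y) (hf : Surjective f) [IsFinite f] :
    (functionFieldMap f hf).Finite := by
  obtain ⟨U, hU, hyU, -⟩ := exists_isAffineOpen_mem_and_subset (Opens.mem_top (genericPoint Y))
  have : Nonempty U := ⟨⟨_, hyU⟩⟩
  have := nonempty_preimage f hf U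
  have := functionField_isFractionRing_of_isAffineOpen X _ (hU.preimage f)
  have := functionField_isFractionRing_of_isAffineOpen Y _ hU
  let := (functionFieldMap f hf).toAlgebra
  let := (f.app U).hom.toAlgebra
  let := ((X.germToFunctionField (f ⁻¹ᵁ U)).hom.comp (f.app U).hom).toAlgebra
  have : Module.Finite Γ(Y, U) Γ(X, f ⁻¹ᵁ U) := f.finite_app U hU
  have : FaithfulSMul Γ(Y, U) Γ(X, f ⁻¹ᵁ U) :=
    (faithfulSMul_iff_algebraMap_injective _ _).mpr (app_injective_of_surjective f U)
  have : IsScalarTower Γ(Y, U) Γ(X, f ⁻¹ᵁ U) X.functionField := .of_algebraMap_eq' rfl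
  have : IsScalarTower Γ(Y, U) Y.functionField X.functionField := .of_algebraMap_eq fun t ↦
    (functionFieldMap_germToFunctionField f hf U t).symm
  exact Module.Finite.of_isLocalization Γ(Y, U) Γ(X, f ⁻¹ᵁ U) (nonZeroDivisors Γ(Y, U))

lemma exists_smul_derivation_integral (f : X ⟶ Y) (hf : Surjective f) [IsFinite f] {U : Y.Opens}
    (hU : IsAffineOpen U) [Nonempty U] [Nonempty (f ⁻¹ᵁ U : X.Opens)]
    (E : Derivation ℤ X.functionField X.functionField) (hE : ∀ l, E (functionFieldMap f hf l) = 0) :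
    ∃ d : Γ(X, f ⁻¹ᵁ U), d ≠ 0 ∧ ∀ a, ∃ a', X.germToFunctionField (f ⁻¹ᵁ U) a' =
      (X.germToFunctionField (f ⁻¹ᵁ U) d • E) (X.germToFunctionField (f ⁻¹ᵁ U) a) := by
  have := functionField_isFractionRing_of_isAffineOpen X _ (hU.preimage f)
  let := (f.app U).hom.toAlgebra
  let := ((X.germToFunctionField (f ⁻¹ᵁ U)).hom.comp (f.app U).hom).toAlgebra
  have : IsScalarTower Γ(Y, U) Γ(X, f ⁻¹ᵁ U) X.functionField := .of_algebraMap_eq' rfl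
  have : Module.Finite Γ(Y, U) Γ(X, f ⁻¹ᵁ U) := f.finite_app U hU
  have hEU (t : Γ(Y, U)) : E (algebraMap Γ(Y, U) X.functionField t) = 0 :=
    (congrArg E (functionFieldMap_germToFunctionField f hf U t).symm).trans (hE _)
  let φ : Γ(X, f ⁻¹ᵁ U) →ₗ[Γ(Y, U)] X.functionField :=
    { toFun a := E (algebraMap _ _ a)
      map_add' a b := by simp only [map_add]
      map_smul' t a := by
        rw [Algebra.smul_def, map_mul, ← IsScalarTower.algebraMap_apply, E.leibniz, hEU, smul_zero,
          add_zero, RingHom.id_apply, algebraMap_smul] }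
  obtain ⟨d, hd⟩ := exists_forall_isInteger_smul_linearMap (nonZeroDivisors Γ(X, f ⁻¹ᵁ U)) φ
  refine ⟨d, nonZeroDivisors.coe_ne_zero d, fun a ↦ (hd a).imp fun a' ha' ↦ ha'.trans ?_⟩
  exact Algebra.smul_def d.1 (φ a)

end

section Quotient

variable {k : Type u} [Field k] {X Y : NormalVariety k}

lemma app_mem_annihilated (f : X ⟶ Y) (V : Y.scheme.Opens) (t : Γ(Y.scheme, V)) :
    (schemeMap f).app V t ∈ annihilated (foliationOf f) (schemeMap f ⁻¹ᵁ V) :=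
  fun V' h _ hD ↦ hD V' le_rfl _ fun _ hx ↦ ⟨V, t, V', le_rfl, h, hx, res_res _ _ _⟩

lemma pow_mem_range_app (f : X ⟶ Y) (hf : Surjective (schemeMap f))
    [IsIntegralHom (schemeMap f)] {p : ℕ}
    (hpow : ∀ x, x ^ p ∈ (functionFieldMap (schemeMap f) hf).range) (V : Y.scheme.Opens)
    (s : Γ(X.scheme, schemeMap f ⁻¹ᵁ V)) : s ^ p ∈ ((schemeMap f).app V).hom.range := by
  by_cases hV : Nonempty V
  · have := nonempty_preimage (schemeMap f) hf V
    refine mem_range_app_of_germ_mem_range (schemeMap f) hf Y.property.normal V _ ?_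
    rw [map_pow]
    exact hpow _
  · exact ⟨0, eq_of_nonempty_imp fun ⟨x⟩ ↦ absurd ⟨⟨_, x.2⟩⟩ hV⟩

variable (p : ℕ) [hp : Fact p.Prime] [CharP k p]

instance charP_functionField : CharP X.scheme.functionField p :=
  have : Nonempty (⊤ : X.scheme.Opens) := ⟨⟨genericPoint X.scheme, trivial⟩⟩
  charP_of_injective_ringHom
    (f := (X.scheme.germToFunctionField ⊤).hom.comp (constants X ⊤)) (RingHom.injective _) p

lemma exists_derivation_functionField (f : X ⟶ Y) (hf : Surjective (schemeMap f))
    [IsFinite (schemeMap f)] (hpow : ∀ x, x ^ p ∈ (functionFieldMap (schemeMap f) hf).range)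
    {x : X.scheme.functionField} (hx : x ∉ (functionFieldMap (schemeMap f) hf).range) :
    ∃ E : Derivation ℤ X.scheme.functionField X.scheme.functionField,
      (∀ l, E (functionFieldMap (schemeMap f) hf l) = 0) ∧ E x ≠ 0 := by
  let := (functionFieldMap (schemeMap f) hf).toAlgebra
  have : FiniteDimensional Y.scheme.functionField X.scheme.functionField :=
    finite_functionFieldMap (schemeMap f) hf
  obtain ⟨D, hD⟩ := exists_derivation_apply_ne_zero p hpow hx
  exact ⟨D.restrictScalars ℤ, D.map_algebraMap, hD⟩

lemma germ_mem_range_of_mem_annihilated (f : X ⟶ Y) (hf : Surjective (schemeMap f))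
    [IsFinite (schemeMap f)] (hpow : ∀ x, x ^ p ∈ (functionFieldMap (schemeMap f) hf).range)
    {V : X.scheme.Opens} [Nonempty V] {U : Y.scheme.Opens} (hU : IsAffineOpen U) [Nonempty U]
    (hUV : schemeMap f ⁻¹ᵁ U ≤ V) {s : Γ(X.scheme, V)} (hs : s ∈ annihilated (foliationOf f) V) :
    X.scheme.germToFunctionField V s ∈ (functionFieldMap (schemeMap f) hf).range := by
  by_contra hcon
  have := nonempty_preimage (schemeMap f) hf U
  obtain ⟨E, hEY, hEs⟩ := exists_derivation_functionField p f hf hpow hcon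
  obtain ⟨d, hd, hdE⟩ := exists_smul_derivation_integral (schemeMap f) hf hU E hEY
  obtain ⟨T, hT, hTE⟩ := exists_mem_foliationOf f hf (hU.preimage (schemeMap f))
    (X.scheme.germToFunctionField _ d • E)
    (fun l ↦ by rw [Derivation.smul_apply, hEY, smul_zero]) hdE
  have hgerm : X.scheme.germToFunctionField _ (res hUV s) = X.scheme.germToFunctionField V s :=
    germToFunctionField_map hUV s
  have hzero := hTE (res hUV s)
  rw [hs _ hUV T hT, map_zero, Derivation.smul_apply, smul_eq_mul, hgerm] at hzero
  refine mul_ne_zero ?_ hEs hzero.symm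
  exact (map_ne_zero_iff _ (X.scheme.germToFunctionField_injective _)).mpr hd

lemma range_app_eq_annihilated (f : X ⟶ Y) (hf : Surjective (schemeMap f))
    [IsFinite (schemeMap f)] (hpow : ∀ x, x ^ p ∈ (functionFieldMap (schemeMap f) hf).range)
    (V : Y.scheme.Opens) :
    Set.range ((schemeMap f).app V) = annihilated (foliationOf f) (schemeMap f ⁻¹ᵁ V) := by
  refine Set.Subset.antisymm (Set.range_subset_iff.mpr (app_mem_annihilated f V)) fun s hs ↦ ?_
  by_cases hV : Nonempty V
  · obtain ⟨U, hU, hyU, hUV⟩ := exists_isAffineOpen_mem_and_subset hV.some.2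
    have : Nonempty U := ⟨⟨_, hyU⟩⟩
    have := nonempty_preimage (schemeMap f) hf V
    exact mem_range_app_of_germ_mem_range (schemeMap f) hf Y.property.normal V s <|
      germ_mem_range_of_mem_annihilated p f hf hpow hU ((schemeMap f).preimage_mono hUV) hs
  · exact ⟨0, eq_of_nonempty_imp fun ⟨x⟩ ↦ absurd ⟨⟨_, x.2⟩⟩ hV⟩

lemma isAffineHom_of_comp_eq_absoluteFrobenius {X Z : Scheme.{u}} (g : X ⟶ Z) [IsAffineHom g]
    [Surjective g] (hX : (p : Γ(X, ⊤)) = 0) (h : Z ⟶ X) (hgh : g ≫ h = absoluteFrobenius p X hX) :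
    IsAffineHom h := by
  refine isAffineHom_of_forall_exists_isAffineOpen h fun x ↦ ?_
  obtain ⟨U, hU, hxU, -⟩ := exists_isAffineOpen_mem_and_subset (Opens.mem_top (g x))
  have hpre : h ⁻¹ᵁ g ⁻¹ᵁ U = U := by
    ext z
    obtain ⟨x, rfl⟩ := g.surjective z
    have hx : h (g x) = x := congr($hgh x)
    change g (h (g x)) ∈ U ↔ g x ∈ U
    rw [hx]
  exact ⟨g ⁻¹ᵁ U, hxU, hU.preimage g, hpre.symm ▸ hU⟩

lemma isPurelyInseparableOfHeightOne_and_isQuotientBy (f : X ⟶ Y) (hf : Surjective (schemeMap f))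
    [IsFinite (schemeMap f)] (hpow : ∀ x, x ^ p ∈ (functionFieldMap (schemeMap f) hf).range) :
    IsPurelyInseparableOfHeightOne p f ∧ IsQuotientBy p (foliationOf f) f := by
  have hinj := app_injective_of_surjective (schemeMap f)
  obtain ⟨h, hh⟩ := exists_comp_eq_absoluteFrobenius (schemeMap f) hinj (natCast_eq_zero p X)
    (pow_mem_range_app f hf hpow)
  have haff := isAffineHom_of_comp_eq_absoluteFrobenius p (schemeMap f) (natCast_eq_zero p X) h hh
  refine ⟨⟨⟨inferInstance, hf, ?_⟩, h, hh⟩, h, hh, haff, fun U ↦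
    ⟨hinj _, range_app_eq_annihilated p f hf hpow _⟩⟩
  let := (functionFieldMap (schemeMap f) hf).toAlgebra
  exact (isPurelyInseparable_iff_pow_mem _ p).mpr fun x ↦ ⟨1, (pow_one p).symm ▸ hpow x⟩

end Quotient

/-! ### The factorisation -/

section Comp
variable {k : Type u} [Field k] {X Y Z : NormalVariety k}

lemma inverseImageSections_comp_subset (g : X ⟶ Z) (f : Z ⟶ Y) (V : X.scheme.Opens) :
    inverseImageSections (g ≫ f) V ⊆ inverseImageSections g V := by
  intro s hs x hx
  obtain ⟨W, t, V', h, h', hx', hst⟩ := hs x hx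
  refine ⟨schemeMap f ⁻¹ᵁ W, (schemeMap f).app W t, V', h, h', hx', hst.trans ?_⟩
  exact congrArg (res h') congr($((schemeMap g).comp_app (schemeMap f) W) t)

lemma fieldRange_le_closure_derivationKer (f : X ⟶ Y) (hf : Surjective (schemeMap f))
    {U : Y.scheme.Opens} (hU : IsAffineOpen U) {V : X.scheme.Opens} [hV : Nonempty V]
    (h : V ≤ schemeMap f ⁻¹ᵁ U) (D : Derivation ℤ Γ(X.scheme, V) Γ(X.scheme, V))
    (hD : ∀ t, D (res h ((schemeMap f).app U t)) = 0) :
    (functionFieldMap (schemeMap f) hf).fieldRange ≤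
      .closure (algebraMap Γ(X.scheme, V) X.scheme.functionField '' derivationKer D) := by
  rintro _ ⟨l, rfl⟩
  have : Nonempty (schemeMap f ⁻¹ᵁ U : X.scheme.Opens) := hV.map fun x ↦ ⟨x.1, h x.2⟩
  have : Nonempty U := this.map fun x ↦ ⟨_, x.2⟩
  have := functionField_isFractionRing_of_isAffineOpen Y.scheme _ hU
  obtain ⟨b, c, -, rfl⟩ := IsFractionRing.div_surjective (A := Γ(Y.scheme, U)) l
  have hmem (b : Γ(Y.scheme, U)) : functionFieldMap (schemeMap f) hf (algebraMap _ _ b) ∈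
      Subfield.closure (algebraMap Γ(X.scheme, V) X.scheme.functionField '' derivationKer D) := by
    refine Subfield.subset_closure ⟨_, hD b, ?_⟩
    exact (germToFunctionField_map h _).trans
      (functionFieldMap_germToFunctionField (schemeMap f) hf U b).symm
  rw [map_div₀]
  exact div_mem (hmem b) (hmem c)

lemma der_eq_zero_of_germ_mem_closure (p : ℕ) [CharP k p] (f : X ⟶ Y)
    (hf : Surjective (schemeMap f)) {U V : X.scheme.Opens} [hV : Nonempty V] (hVU : V ≤ U)
    {D : TangentSection X U} (hD : D ∈ foliationOf f U) {s : Γ(X.scheme, V)}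
    (hs : X.scheme.germToFunctionField V s ∈ Subfield.closure
      (↑(functionFieldMap (schemeMap f) hf).fieldRange ∪ Set.range (fun x ↦ x ^ p))) :
    D.der V hVU s = 0 := by
  obtain ⟨x, hxV⟩ := id hV
  obtain ⟨W, hW, hxW, -⟩ := exists_isAffineOpen_mem_and_subset (Opens.mem_top (schemeMap f x))
  obtain ⟨A, hA, hxA, hAVW⟩ := exists_isAffineOpen_mem_and_subset
    (U := V ⊓ schemeMap f ⁻¹ᵁ W) ⟨hxV, hxW⟩
  have hAV : A ≤ V := hAVW.trans inf_le_left
  have hAW : A ≤ schemeMap f ⁻¹ᵁ W := hAVW.trans inf_le_right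
  have : Nonempty A := ⟨⟨x, hxA⟩⟩
  have := functionField_isFractionRing_of_isAffineOpen X.scheme _ hA
  apply res_injective hAV
  rw [map_zero, ← D.der_res]
  refine mem_derivationKer_of_mem_closure (K := X.scheme.functionField) (D.der A (hAV.trans hVU)) ?_
  have hres : algebraMap _ X.scheme.functionField (res hAV s) = X.scheme.germToFunctionField V s :=
    germToFunctionField_map hAV s
  rw [hres]
  refine Subfield.closure_le.mpr (Set.union_subset ?_ ?_) hs
  · exact fieldRange_le_closure_derivationKer f hf hW hAW _ fun t ↦
      hD A _ _ fun y hy ↦ ⟨W, t, A, le_rfl, hAW, hy, res_res _ _ _⟩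
  · rintro _ ⟨x, rfl⟩
    exact pow_mem_closure_derivationKer _
      (natCast_sections_eq_zero p X.scheme (natCast_eq_zero p X) A) x

lemma foliationOf_comp (p : ℕ) [CharP k p] (g : X ⟶ Z) (f : Z ⟶ Y) (hg : Surjective (schemeMap g))
    (hgf : Surjective (schemeMap (g ≫ f)))
    (hM : (functionFieldMap (schemeMap g) hg).fieldRange ≤ Subfield.closure
      (↑(functionFieldMap (schemeMap (g ≫ f)) hgf).fieldRange ∪ Set.range (fun x ↦ x ^ p))) :
    foliationOf (g ≫ f) = foliationOf g := by
  funext U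
  refine Set.Subset.antisymm (fun D hD V hV s hs ↦ eq_of_nonempty_imp fun _ ↦ ?_)
    fun D hD V hV s hs ↦ hD V hV s (inverseImageSections_comp_subset g f V hs)
  exact der_eq_zero_of_germ_mem_closure p (g ≫ f) hgf hV hD
    (hM (germToFunctionField_mem_range_of_mem_inverseImageSections g hg hs))

end Comp

section Factorization
variable {k : Type u} [Field k] {X Y Z : NormalVariety k} (p : ℕ) [hp : Fact p.Prime] [CharP k p]

/-- The morphism `f : X → Y` is a composite of morphisms of height one, each of which is the
quotient by the `p`-closed foliation attached to the rest of the composite. The endpoints of a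
`ComposableArrows` being `X` and `Y` only up to equality, these equalities are part of the data. -/
def HasQuotientFactorization (f : X ⟶ Y) : Prop :=
  ∃ (n : ℕ) (Z : ComposableArrows (NormalVariety k) n) (hX : Z.left = X) (hY : Z.right = Y),
    f = eqToHom hX.symm ≫ Z.hom ≫ eqToHom hY ∧
    ∀ i : Fin n,
      IsPurelyInseparableOfHeightOne p (Z.map' i (i + 1)) ∧
      IsPClosedFoliation p (foliationOf (Z.map' i n ≫ eqToHom hY)) ∧
      IsQuotientBy p (foliationOf (Z.map' i n ≫ eqToHom hY)) (Z.map' i (i + 1))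

lemma HasQuotientFactorization.id (X : NormalVariety k) : HasQuotientFactorization p (𝟙 X) :=
  ⟨0, .mk₀ X, rfl, rfl, ((Category.id_comp _).trans (Category.comp_id _)).symm, fun i ↦
    i.elim0⟩

variable {p}

lemma HasQuotientFactorization.precomp {g : X ⟶ Z} {f : Z ⟶ Y} (hf : HasQuotientFactorization p f)
    (hg : IsPurelyInseparableOfHeightOne p g) (hq : IsQuotientBy p (foliationOf (g ≫ f)) g) :
    HasQuotientFactorization p (g ≫ f) := by
  obtain ⟨n, Z, rfl, rfl, rfl, H⟩ := hf
  have hhom : (Z.precomp g).hom ≫ 𝟙 _ = g ≫ 𝟙 _ ≫ Z.hom ≫ 𝟙 _ := by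
    rw [Category.comp_id, Category.id_comp, Category.comp_id]
    exact (Z.precomp g).map'_comp 0 1 (n + 1)
  refine ⟨n + 1, Z.precomp g, rfl, rfl, hhom.symm.trans (Category.id_comp _).symm, fun i ↦ ?_⟩
  cases i using Fin.cases with
  | zero =>
    refine ⟨hg, isPClosedFoliation_foliationOf p _, ?_⟩
    exact (congrArg (fun a ↦ IsQuotientBy p (foliationOf a) g) hhom).mpr hq
  | succ i => exact H i

lemma hasQuotientFactorization_of_pow_mem_range (f : X ⟶ Y) (hf : Surjective (schemeMap f))
    [IsFinite (schemeMap f)] (hpow : ∀ x, x ^ p ∈ (functionFieldMap (schemeMap f) hf).range) :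
    HasQuotientFactorization p f := by
  obtain ⟨hf₁, hf₂⟩ := isPurelyInseparableOfHeightOne_and_isQuotientBy p f hf hpow
  rw [← Category.comp_id f] at hf₂ ⊢
  exact (HasQuotientFactorization.id p Y).precomp hf₁ (by simpa using hf₂)

lemma hasQuotientFactorization_of_pow_pow_mem_range (e : ℕ) (f : X ⟶ Y)
    (hf : Surjective (schemeMap f)) [IsFinite (schemeMap f)]
    (hpow : ∀ x, x ^ p ^ e ∈ (functionFieldMap (schemeMap f) hf).range) :
    HasQuotientFactorization p f := by
  induction e generalizing X with
  | zero =>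
    exact hasQuotientFactorization_of_pow_mem_range f hf fun x ↦
      pow_mem (pow_one x ▸ pow_zero p ▸ hpow x) p
  | succ e ih =>
    have : ExpChar X.scheme.functionField p := .prime hp.out
    obtain ⟨Z, g, f, rfl, _, _, hf', hg, hgM⟩ := exists_intermediate_normalVariety f
      (.closure (↑(functionFieldMap (schemeMap f) hf).fieldRange ∪ Set.range (fun x ↦ x ^ p)))
      fun x hx ↦ Subfield.subset_closure (Or.inl hx)
    have hpowg (x) : x ^ p ∈ (functionFieldMap (schemeMap g) hg).range :=
      hgM.ge (Subfield.subset_closure (Or.inr ⟨x, rfl⟩))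
    have hpowf (z) : z ^ p ^ e ∈ (functionFieldMap (schemeMap f) hf').range := by
      obtain ⟨y, hy⟩ := pow_mem_of_mem_closure p _ hpow (hgM.le ⟨z, rfl⟩)
      refine ⟨y, (functionFieldMap (schemeMap g) hg).injective ?_⟩
      rw [map_pow, ← hy]
      exact (functionFieldMap_comp (schemeMap g) hg (schemeMap f) hf' hf y).symm
    obtain ⟨hg₁, hg₂⟩ := isPurelyInseparableOfHeightOne_and_isQuotientBy p g hg hpowg
    exact (ih f hf' hpowf).precomp hg₁ (foliationOf_comp p g f hg hf hgM.le ▸ hg₂)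

lemma exists_forall_pow_pow_mem_range (f : X ⟶ Y) (hf : Surjective (schemeMap f))
    [IsFinite (schemeMap f)]
    (hpi : @IsPurelyInseparable Y.scheme.functionField X.scheme.functionField _ _
      (functionFieldMap (schemeMap f) hf).toAlgebra) :
    ∃ e : ℕ, ∀ x, x ^ p ^ e ∈ (functionFieldMap (schemeMap f) hf).range := by
  let := (functionFieldMap (schemeMap f) hf).toAlgebra
  have : ExpChar Y.scheme.functionField p := .prime hp.out
  have : FiniteDimensional Y.scheme.functionField X.scheme.functionField :=
    finite_functionFieldMap (schemeMap f) hf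
  exact ⟨IsPurelyInseparable.exponent Y.scheme.functionField X.scheme.functionField,
    IsPurelyInseparable.exponent_def' _ p⟩

end Factorization

end

theorem proposition4p1_general (p : ℕ) [Fact p.Prime] {k : Type u} [Field k] [CharP k p]
    {X Y : NormalVariety k} (f : X ⟶ Y) (hf : IsPurelyInseparableHom (schemeMap f)) :
    HasQuotientFactorization p f := by
  obtain ⟨_, hsurj, hpi⟩ := hf
  obtain ⟨e, he⟩ := exists_forall_pow_pow_mem_range f hsurj hpi
  exact hasQuotientFactorization_of_pow_pow_mem_range e f hsurj he

end InsepFactor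

/-- With `l = n + 1`, the variety `Z_{i+1}` of the factorisation is `Z.obj' i`. -/
theorem proposition4p1 (p : ℕ) [Fact p.Prime] (k : Type u) [Field k] [PerfectField k] [CharP k p]
    (X Y : NormalVariety k) (f : X ⟶ Y) (hf : IsPurelyInseparableHom (schemeMap f)) :
    ∃ (n : ℕ) (Z : ComposableArrows (NormalVariety k) n) (hX : Z.left = X) (hY : Z.right = Y),
      f = eqToHom hX.symm ≫ Z.hom ≫ eqToHom hY ∧
      ∀ (i : ℕ) (hi : i < n),
        IsPurelyInseparableOfHeightOne p (Z.map' i (i + 1)) ∧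
        IsPClosedFoliation p (foliationOf (Z.map' i n ≫ eqToHom hY)) ∧
        IsQuotientBy p (foliationOf (Z.map' i n ≫ eqToHom hY)) (Z.map' i (i + 1)) :=
  have ⟨n, Z, hX, hY, hfac, H⟩ := proposition4p1_general p f hf
  ⟨n, Z, hX, hY, hfac, fun i hi ↦ H ⟨i, hi⟩⟩
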